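/- **Theorem 3.1.** Let $\theta>0$ and let $G=\{G_t,\ t\in\mathbb R\}$ be a real measurable process on a probability space with stationary increments (for every $s\in\mathbb R$, $\{G_t-G_0\}_{t\in\mathbb R}$ and $\{G_{t+s}-G_s\}_{t\in\mathbb R}$ have the same finite-dimensional distributions) satisfying $(\mathcal A)$ $G_0=0$ a.s., and there is $\gamma\in(0,1)$ such that for every real $q\ge 2$ there is $c_q>0$ with $E\left[|G_t-G_s|^q\right]\le c_q|t-s|^{q\gamma}$ for all $s,t\in\mathbb R$. Then $G$ has a modification with continuous paths. Let $G$ now denote any modification with almost surely continuous paths. Almost surely, the pathwise Riemann–Stieltjes integrals $$Z_t=\int_{-\infty}^t e^{-\theta(t-s)}\,dG_s\quad (t\in\mathbb R),\qquad X_t=e^{-\theta t}\int_0^t e^{\theta r}\,dG_r\quad(t\ge 0)$$ exist (the first as the limit of the integrals over $[a,t]$ as $a\to-\infty$), and the following holds. (a) Almost surely, $\{Z_t,\ t\ge0\}$ is the unique continuous solution of the Langevin equation $dZ_t=-\theta Z_t\,dt+dG_t$, $t\ge0$, $Z_0=\int_{-\infty}^0e^{\theta s}\,dG_s$, that is, of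 $Z_t=Z_0-\theta\int_0^tZ_s\,ds+G_t$, $t\ge 0$. The process $\{Z_t,\ t\ge0\}$ is strictly stationary: its finite-dimensional distributions are invariant under time shifts. (b) Assume in addition that $\rho_G(t):=E(G_t^2)$, $t\in\mathbb R$, is twice continuously differentiable on $\mathbb R\setminus\{0\}$. Then $Z_t,X_t\in L^2$ for all $t\ge0$, and: * for every $t\ge0$, $$E(Z_tZ_0)=e^{-\theta t}E(Z_0^2)+\frac{e^{-\theta t}}2\int_0^t\int_{-\infty}^0e^{\theta u}e^{\theta v}\rho_G''(v-u)\,du\,dv,$$ provided that the iterated integral converges (as an improper integral: at $-\infty$ in $u$ for every $v\in(0,t)$, and then at $0$ in $v$); * for all $0\le s\le t$, $$E(X_sX_t)=e^{-\theta(t-s)}E(X_s^2)+\frac{e^{-\theta t}e^{-\theta s}}2\int_s^te^{\theta v}\int_0^se^{\theta u}\rho_G''(v-u)\,du\,dv,$$ provided that the integral converges (as an improper integral at $v=s$); * there is a constant $C$ with $\left|E(X_t^2)-E(Z_0^2)\right|\le Ce^{-\theta t}$ for all $t\ge0$; * the integral $\int_0^\infty e^{-\theta t}\rho_G(t)\,dt$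 converges and $$E(Z_0^2)=\frac\theta2\int_0^\infty e^{-\theta t}\rho_G(t)\,dt.$$ -/

import Mathlib

open MeasureTheory ProbabilityTheory Filter Set
open scoped Topology ENNReal

/-! ### Processes -/

/-- A real process indexed by `ℝ` has stationary increments: for every `s`, the processes
`(G t - G 0)_t` and `(G (t + s) - G s)_t` have the same finite-dimensional distributions. -/
def HasStationaryIncrements {Ω : Type*} [MeasurableSpace Ω] (G : ℝ → Ω → ℝ)
    (P : Measure Ω) : Prop :=
  ∀ (s : ℝ) (n : ℕ) (τ : Fin n → ℝ),
    IdentDistrib (fun ω (i : Fin n) => G (τ i) ω - G 0 ω)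
      (fun ω (i : Fin n) => G (τ i + s) ω - G s ω) P P

/-- Strict stationarity of a process observed at the times `t ≥ 0`: its finite-dimensional
distributions are invariant under time shifts. -/
def IsStationaryProcess {Ω : Type*} [MeasurableSpace Ω] (Z : ℝ → Ω → ℝ)
    (P : Measure Ω) : Prop :=
  ∀ (h : ℝ), 0 ≤ h → ∀ (n : ℕ) (τ : Fin n → ℝ), (∀ i, 0 ≤ τ i) →
    IdentDistrib (fun ω (i : Fin n) => Z (τ i + h) ω) (fun ω (i : Fin n) => Z (τ i) ω) P P

/-- The moment assumption: `G 0 = 0` a.s., and for some `γ ∈ (0, 1)` and every real `q ≥ 2` there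
is `c > 0` with `E |G t - G s| ^ q ≤ c * |t - s| ^ (q * γ)` for all `s, t`. The expectation is a
lower Lebesgue integral, so that its finiteness is part of the assumption. -/
def IncrementMomentAssumption {Ω : Type*} [MeasurableSpace Ω] (G : ℝ → Ω → ℝ)
    (P : Measure Ω) : Prop :=
  (∀ᵐ ω ∂P, G 0 ω = 0) ∧
    ∃ γ : ℝ, 0 < γ ∧ γ < 1 ∧ ∀ q : ℝ, 2 ≤ q → ∃ c : ℝ, 0 < c ∧ ∀ s t : ℝ,
      ∫⁻ ω, ENNReal.ofReal (|G t ω - G s ω| ^ q) ∂P ≤ ENNReal.ofReal (c * |t - s| ^ (q * γ))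

/-- `G'` is a modification of `G` with almost surely continuous paths. -/
def IsContinuousModification {Ω : Type*} [MeasurableSpace Ω] (P : Measure Ω)
    (G G' : ℝ → Ω → ℝ) : Prop :=
  (∀ t, G' t =ᵐ[P] G t) ∧ ∀ᵐ ω ∂P, Continuous fun t => G' t ω

/-! ### Riemann-Stieltjes integrals -/

/-- `I` is the Riemann-Stieltjes integral of `f` with respect to `g` on `[a, b]`: the sums
`∑ f (ξ i) * (g (x (i + 1)) - g (x i))` over the tagged partitions
`a = x 0 ≤ x 1 ≤ ⋯ ≤ x n = b`, `ξ i ∈ [x i, x (i + 1)]`, tend to `I` as the mesh tends to `0`. -/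
def HasRSIntegral (f g : ℝ → ℝ) (a b I : ℝ) : Prop :=
  a ≤ b ∧ ∀ ε : ℝ, 0 < ε → ∃ δ : ℝ, 0 < δ ∧
    ∀ (n : ℕ) (x ξ : ℕ → ℝ), x 0 = a → x n = b →
      (∀ i < n, x i ≤ ξ i ∧ ξ i ≤ x (i + 1) ∧ x (i + 1) - x i < δ) →
      |∑ i ∈ Finset.range n, f (ξ i) * (g (x (i + 1)) - g (x i)) - I| < ε

/-- `I` is the improper Riemann-Stieltjes integral of `f` with respect to `g` on `(-∞, b]`: the
limit of the integrals on `[a, b]` as `a → -∞`. -/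
def HasRSIntegralIic (f g : ℝ → ℝ) (b I : ℝ) : Prop :=
  ∃ J : ℝ → ℝ, (∀ a ≤ b, HasRSIntegral f g a b (J a)) ∧ Tendsto J atBot (𝓝 I)

open Classical in
/-- The Riemann-Stieltjes integral on `[a, b]`, with value `0` if it does not exist. -/
noncomputable def rsIntegral (f g : ℝ → ℝ) (a b : ℝ) : ℝ :=
  if h : ∃ I, HasRSIntegral f g a b I then h.choose else 0

open Classical in
/-- The improper Riemann-Stieltjes integral on `(-∞, b]`, with value `0` if it does not exist. -/
noncomputable def rsIntegralIic (f g : ℝ → ℝ) (b : ℝ) : ℝ :=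
  if h : ∃ I, HasRSIntegralIic f g b I then h.choose else 0

/-! ### Convergent improper integrals -/

/-- The integral of `f` up to `b`, with its lower limit approached along the filter `l`
(`atBot` for `-∞`, `𝓝[>] a` for `a⁺`), converges, as an improper integral, to `I`. -/
def HasImproperIntegral (l : Filter ℝ) (b : ℝ) (f : ℝ → ℝ) (I : ℝ) : Prop :=
  (∀ᶠ a in l, IntervalIntegrable f volume a b) ∧
    Tendsto (fun a => ∫ x in a..b, f x) l (𝓝 I)

/-! ### Langevin equation and Ornstein-Uhlenbeck processes -/

/-- `y` is a continuous solution on `[0, ∞)` of the Langevin equation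
`dy = -θ y dt + dg`, `y 0 = ξ`, in integrated form (the driving path starts at `0`). -/
def IsLangevinSolution (θ : ℝ) (g : ℝ → ℝ) (ξ : ℝ) (y : ℝ → ℝ) : Prop :=
  ContinuousOn y (Ici 0) ∧ ∀ t, 0 ≤ t → y t = ξ - θ * (∫ s in (0 : ℝ)..t, y s) + g t

/-- `Z t = ∫_{-∞}^t e^{-θ (t - s)} dG_s`, pathwise. -/
noncomputable def ouZ {Ω : Type*} (θ : ℝ) (G : ℝ → Ω → ℝ) (t : ℝ) (ω : Ω) : ℝ :=
  rsIntegralIic (fun s => Real.exp (-θ * (t - s))) (fun s => G s ω) t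

/-- `X t = e^{-θ t} ∫_0^t e^{θ r} dG_r` for `t ≥ 0`, pathwise. -/
noncomputable def ouX {Ω : Type*} (θ : ℝ) (G : ℝ → Ω → ℝ) (t : ℝ) (ω : Ω) : ℝ :=
  Real.exp (-θ * t) * rsIntegral (fun r => Real.exp (θ * r)) (fun r => G r ω) 0 t

/-- `ρ_G t = E (G_t ^ 2)`. -/
noncomputable def rhoG {Ω : Type*} [MeasurableSpace Ω] (G : ℝ → Ω → ℝ) (P : Measure Ω)
    (t : ℝ) : ℝ :=
  ∫ ω, (G t ω) ^ 2 ∂P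

/-! ### Riemann-Stieltjes integrals of differentiable integrands -/

/-! The exponential kernels are smooth, so every Riemann–Stieltjes integral against a continuous
path `g` can be integrated by parts (`hasRSIntegral_of_hasDerivAt`) and becomes boundary terms minus
an ordinary integral of `g`. At most quadratic growth of the path makes the integral from `-∞`
converge, and `Z t = e^{-θ t} (ouPast + ouXi t)`. The Langevin equation is then the fundamental
theorem of calculus. Uniqueness holds because the difference `d` of two solutions satisfies `d = -θ
∫ d`.

Such paths come from a Kolmogorov argument (`exists_regular_version`): high moments bound all dyadic
increments at once, with a weight summable over positions on the whole line. This gives a version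
`H` whose paths are all continuous, start at `0` and grow at most quadratically. Any continuous
modification has almost surely the same paths as `H`, so everything is proved for `H`.

Stationarity of `Z` is inherited from Riemann–Stieltjes sums. Since the kernel depends only on `t -
s`, a time shift turns each sum into the same function of the shifted increments of `G`. The mesh
tends to `0`, then the lower limit to `-∞`.

For second moments, polarization gives `E(H_u H_v) = (ρ u + ρ v - ρ (v - u)) / 2`, and Fubini
reduces every covariance to the convolutions `Ψ v = ∫_S e^{θ u} ρ (v - u) du`. The function `e^{θ v}
Ψ v` solves a linear first-order equation whose inhomogeneity involves `ρ` alone, so covariances get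
closed forms without derivatives of `ρ`. Integrating by parts twice shows that the inner integral of
`ρ''` is the derivative of such a closed form, continuous up to the singular endpoint; this proves
both covariance formulas. Integrating the same equation over `(-∞, 0]` gives the variance, and `X t
= Z t - e^{-θ t} Z 0` gives the exponential rate. -/

theorem abs_stieltjes_term_sub_le {f f' g : ℝ → ℝ} (hf : ∀ x, HasDerivAt f (f' x) x)
    (hf' : Continuous f') (hg : Continuous g) {p ξ q M η : ℝ} (h₁ : p ≤ ξ) (h₂ : ξ ≤ q)
    (hM : ∀ u ∈ Icc p q, |f' u| ≤ M) (hη : ∀ u ∈ Icc p q, ∀ v ∈ Icc p q, |g u - g v| ≤ η) :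
    |f ξ * (g q - g p) - (f q * g q - f p * g p - ∫ x in p..q, f' x * g x)|
      ≤ M * η * (q - p) := by
  have hM0 : 0 ≤ M := (abs_nonneg _).trans (hM p ⟨le_rfl, h₁.trans h₂⟩)
  have hfg : Continuous fun x => f' x * g x := hf'.mul hg
  have hfc : ∀ c, Continuous fun x => f' x * c := fun c => hf'.mul continuous_const
  have i1 : ∫ x in p..ξ, f' x * (g x - g p) = (∫ x in p..ξ, f' x * g x) - (f ξ - f p) * g p := by
    simp_rw [mul_sub]
    rw [intervalIntegral.integral_sub (hfg.intervalIntegrable _ _)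
      ((hfc _).intervalIntegrable _ _), intervalIntegral.integral_mul_const,
      intervalIntegral.integral_eq_sub_of_hasDerivAt (fun x _ => hf x)
        (hf'.intervalIntegrable _ _)]
  have i2 : ∫ x in ξ..q, f' x * (g x - g q) = (∫ x in ξ..q, f' x * g x) - (f q - f ξ) * g q := by
    simp_rw [mul_sub]
    rw [intervalIntegral.integral_sub (hfg.intervalIntegrable _ _)
      ((hfc _).intervalIntegrable _ _), intervalIntegral.integral_mul_const,
      intervalIntegral.integral_eq_sub_of_hasDerivAt (fun x _ => hf x)
        (hf'.intervalIntegrable _ _)]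
  have i3 : ∫ x in p..q, f' x * g x = (∫ x in p..ξ, f' x * g x) + ∫ x in ξ..q, f' x * g x :=
    (intervalIntegral.integral_add_adjacent_intervals (hfg.intervalIntegrable _ _)
      (hfg.intervalIntegrable _ _)).symm
  -- Splitting at the tag leaves only oscillations of `g`, measured from `g p` on the left of `ξ`
  -- and from `g q` on the right.
  have e : f ξ * (g q - g p) - (f q * g q - f p * g p - ∫ x in p..q, f' x * g x)
      = (∫ x in p..ξ, f' x * (g x - g p)) + ∫ x in ξ..q, f' x * (g x - g q) := by
    rw [i1, i2, i3]; ring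
  have b1 : ‖∫ x in p..ξ, f' x * (g x - g p)‖ ≤ M * η * |ξ - p| := by
    refine intervalIntegral.norm_integral_le_of_norm_le_const fun x hx => ?_
    rw [uIoc_of_le h₁] at hx
    have hx' : x ∈ Icc p q := ⟨hx.1.le, hx.2.trans h₂⟩
    rw [Real.norm_eq_abs, abs_mul]
    exact mul_le_mul (hM x hx') (hη x hx' p ⟨le_rfl, h₁.trans h₂⟩) (abs_nonneg _) hM0
  have b2 : ‖∫ x in ξ..q, f' x * (g x - g q)‖ ≤ M * η * |q - ξ| := by
    refine intervalIntegral.norm_integral_le_of_norm_le_const fun x hx => ?_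
    rw [uIoc_of_le h₂] at hx
    have hx' : x ∈ Icc p q := ⟨h₁.trans hx.1.le, hx.2⟩
    rw [Real.norm_eq_abs, abs_mul]
    exact mul_le_mul (hM x hx') (hη x hx' q ⟨h₁.trans h₂, le_rfl⟩) (abs_nonneg _) hM0
  rw [abs_of_nonneg (sub_nonneg.2 h₁)] at b1
  rw [abs_of_nonneg (sub_nonneg.2 h₂)] at b2
  rw [e]
  calc _ ≤ M * η * (ξ - p) + M * η * (q - ξ) := (abs_add_le _ _).trans (add_le_add b1 b2)
    _ = _ := by ring

/-- The integrated-by-parts value is additive over the partition, so the error is a sum of local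
errors, each at most the oscillation of `g` times `M` times the length of the piece. -/
theorem hasRSIntegral_of_hasDerivAt {f f' g : ℝ → ℝ} (hf : ∀ x, HasDerivAt f (f' x) x)
    (hf' : Continuous f') (hg : Continuous g) {a b : ℝ} (hab : a ≤ b) :
    HasRSIntegral f g a b (f b * g b - f a * g a - ∫ x in a..b, f' x * g x) := by
  refine ⟨hab, fun ε hε => ?_⟩
  obtain ⟨M, hM⟩ := (isCompact_Icc (a := a) (b := b)).exists_bound_of_continuousOn hf'.continuousOn
  have hM0 : 0 ≤ M := (norm_nonneg _).trans (hM a ⟨le_rfl, hab⟩)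
  have hba : 0 ≤ b - a := sub_nonneg.2 hab
  -- The two added ones keep the denominator positive when `M = 0` or `a = b`, and make the final
  -- inequality strict.
  set η : ℝ := ε / ((M + 1) * (b - a + 1)) with hηdef
  have hη : 0 < η := by positivity
  have huc := (isCompact_Icc (a := a) (b := b)).uniformContinuousOn_of_continuous hg.continuousOn
  obtain ⟨δ, hδ, H⟩ := Metric.uniformContinuousOn_iff.1 huc η hη
  refine ⟨δ, hδ, fun n x ξ hx0 hxn hxξ => ?_⟩
  have mono : ∀ i j, i ≤ j → j ≤ n → x i ≤ x j := by
    intro i j hij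
    induction j, hij using Nat.le_induction with
    | base => intro _; exact le_rfl
    | succ j _ ih =>
      intro hj
      have := hxξ j (by omega)
      exact (ih (by omega)).trans (this.1.trans this.2.1)
  have hfg : Continuous fun x => f' x * g x := hf'.mul hg
  have hsum : ∑ i ∈ Finset.range n, f (ξ i) * (g (x (i + 1)) - g (x i))
        - (f b * g b - f a * g a - ∫ x in a..b, f' x * g x)
      = ∑ i ∈ Finset.range n, (f (ξ i) * (g (x (i + 1)) - g (x i)) -
          (f (x (i + 1)) * g (x (i + 1)) - f (x i) * g (x i)
            - ∫ y in x i..x (i + 1), f' y * g y)) := by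
    rw [Finset.sum_sub_distrib, Finset.sum_sub_distrib,
      Finset.sum_range_sub (fun i => f (x i) * g (x i)),
      intervalIntegral.sum_integral_adjacent_intervals
        (fun k _ => hfg.intervalIntegrable _ _), hx0, hxn]
  rw [hsum]
  calc _ ≤ ∑ i ∈ Finset.range n, M * η * (x (i + 1) - x i) := by
        refine (Finset.abs_sum_le_sum_abs _ _).trans (Finset.sum_le_sum fun i hi => ?_)
        rw [Finset.mem_range] at hi
        obtain ⟨h1, h2, h3⟩ := hxξ i hi
        have sub : Icc (x i) (x (i + 1)) ⊆ Icc a b :=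
          Icc_subset_Icc (hx0 ▸ mono 0 i (by omega) (by omega))
            (hxn ▸ mono (i + 1) n (by omega) le_rfl)
        refine abs_stieltjes_term_sub_le hf hf' hg h1 h2 (fun u hu => hM u (sub hu)) ?_
        intro u hu v hv
        have := H u (sub hu) v (sub hv) (by
          rw [Real.dist_eq, abs_lt]; constructor <;> linarith [hu.1, hu.2, hv.1, hv.2])
        exact this.le
    _ = M * η * (b - a) := by rw [← Finset.mul_sum, Finset.sum_range_sub, hx0, hxn]
    _ < (M + 1) * η * (b - a + 1) := by
        have : M * (b - a) < (M + 1) * (b - a + 1) := by nlinarith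
        nlinarith
    _ = ε := by rw [hηdef]; field_simp

/-- Points of the uniform partition of `[a, b]` into `m + 1` intervals. -/
noncomputable def uniformPoint (a b : ℝ) (m i : ℕ) : ℝ := a + (b - a) * (i / (m + 1))

/-- Left Riemann-Stieltjes sum over the uniform partition of `[a, b]` into `m + 1` intervals. -/
noncomputable def uniformRSSum (f g : ℝ → ℝ) (a b : ℝ) (m : ℕ) : ℝ :=
  ∑ i ∈ Finset.range (m + 1), f (uniformPoint a b m i) *
    (g (uniformPoint a b m (i + 1)) - g (uniformPoint a b m i))

/-- One explicit sequence of sums serves twice: it gives uniqueness of the integral, and it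
expresses the integral as a limit of finite combinations of increments, whose laws are known. -/
theorem HasRSIntegral.tendsto_uniformRSSum {f g : ℝ → ℝ} {a b I : ℝ}
    (h : HasRSIntegral f g a b I) : Tendsto (uniformRSSum f g a b) atTop (𝓝 I) := by
  obtain ⟨hab, h⟩ := h
  have hba : 0 ≤ b - a := sub_nonneg.2 hab
  rw [Metric.tendsto_atTop]
  intro ε hε
  obtain ⟨δ, hδ, H⟩ := h ε hε
  obtain ⟨N, hN⟩ := exists_nat_gt ((b - a) / δ)
  refine ⟨N, fun m hm => ?_⟩
  have hm' : (b - a) / δ < (m : ℝ) + 1 := by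
    have : (N : ℝ) ≤ m := by exact_mod_cast hm
    linarith
  have step : ∀ i, uniformPoint a b m (i + 1) - uniformPoint a b m i = (b - a) / (m + 1) := by
    intro i; unfold uniformPoint; push_cast; field_simp; ring
  refine H (m + 1) (uniformPoint a b m) (uniformPoint a b m) (by simp [uniformPoint]) ?_ ?_
  · unfold uniformPoint
    push_cast
    rw [div_self (by positivity)]; ring
  · intro i _
    refine ⟨le_rfl, ?_, ?_⟩
    · have : 0 ≤ (b - a) / ((m : ℝ) + 1) := by positivity
      linarith [step i]
    · rw [step i, div_lt_iff₀ (by positivity)]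
      rw [div_lt_iff₀ hδ] at hm'
      linarith

theorem HasRSIntegral.unique {f g : ℝ → ℝ} {a b I I' : ℝ} (h : HasRSIntegral f g a b I)
    (h' : HasRSIntegral f g a b I') : I = I' :=
  tendsto_nhds_unique h.tendsto_uniformRSSum h'.tendsto_uniformRSSum

theorem HasRSIntegral.rsIntegral_eq {f g : ℝ → ℝ} {a b I : ℝ} (h : HasRSIntegral f g a b I) :
    rsIntegral f g a b = I := by
  have hex : ∃ I, HasRSIntegral f g a b I := ⟨I, h⟩
  rw [rsIntegral, dif_pos hex]
  exact hex.choose_spec.unique h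

theorem HasRSIntegralIic.unique {f g : ℝ → ℝ} {b I I' : ℝ} (h : HasRSIntegralIic f g b I)
    (h' : HasRSIntegralIic f g b I') : I = I' := by
  obtain ⟨J, hJ, hI⟩ := h
  obtain ⟨J', hJ', hI'⟩ := h'
  refine tendsto_nhds_unique hI (hI'.congr' ?_)
  filter_upwards [eventually_le_atBot b] with a ha using (hJ' a ha).unique (hJ a ha)

theorem HasRSIntegralIic.rsIntegralIic_eq {f g : ℝ → ℝ} {b I : ℝ}
    (h : HasRSIntegralIic f g b I) : rsIntegralIic f g b = I := by
  have hex : ∃ I, HasRSIntegralIic f g b I := ⟨I, h⟩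
  rw [rsIntegralIic, dif_pos hex]
  exact hex.choose_spec.unique h

/-! ### Paths of exponential growth -/

/-- A continuous function with `|g u| ≤ C * exp (κ * |u|)` for some `C`. -/
def ExpGrowth (κ : ℝ) (g : ℝ → ℝ) : Prop :=
  Continuous g ∧ ∃ C, ∀ u, |g u| ≤ C * Real.exp (κ * |u|)

theorem ExpGrowth.integrableOn {κ θ : ℝ} {g : ℝ → ℝ} (hg : ExpGrowth κ g) (h0 : 0 ≤ κ)
    (h : κ < θ) (T : ℝ) : IntegrableOn (fun u => Real.exp (θ * u) * g u) (Iic T) := by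
  obtain ⟨hc, C, hC⟩ := hg
  have hC0 : 0 ≤ C := by
    have := (abs_nonneg _).trans (hC 0)
    simpa using this
  have hi : IntegrableOn (fun u => Real.exp (2 * κ * |T|) * C * Real.exp ((θ - κ) * u)) (Iic T) :=
    (integrableOn_exp_mul_Iic (by linarith) T).const_mul _
  refine hi.mono' (by fun_prop) ?_
  filter_upwards [self_mem_ae_restrict measurableSet_Iic] with u hu
  rw [Real.norm_eq_abs, abs_mul, abs_of_pos (Real.exp_pos _)]
  -- For `u ≤ T` one has `|u| ≤ 2 |T| - u`, also when `T` and `u` are positive.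
  have h1 : Real.exp (κ * |u|) ≤ Real.exp (2 * κ * |T|) * Real.exp (-κ * u) := by
    rw [← Real.exp_add, Real.exp_le_exp]
    have hu : u ≤ T := hu
    have : |u| ≤ 2 * |T| - u := by
      rcases abs_cases u with ⟨h, _⟩ | ⟨h, _⟩ <;> rcases abs_cases T with ⟨h', _⟩ | ⟨h', _⟩ <;>
        linarith
    nlinarith
  calc _ ≤ Real.exp (θ * u) * (C * (Real.exp (2 * κ * |T|) * Real.exp (-κ * u))) := by
        refine mul_le_mul_of_nonneg_left ((hC u).trans ?_) (Real.exp_pos _).le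
        exact mul_le_mul_of_nonneg_left h1 hC0
    _ = _ := by
        rw [show (θ - κ) * u = θ * u + -κ * u by ring, Real.exp_add]; ring

theorem ExpGrowth.tendsto_exp_mul {κ θ : ℝ} {g : ℝ → ℝ} (hg : ExpGrowth κ g)
    (h : κ < θ) : Tendsto (fun u => Real.exp (θ * u) * g u) atBot (𝓝 0) := by
  obtain ⟨hc, C, hC⟩ := hg
  have hl : Tendsto (fun u : ℝ => C * Real.exp ((θ - κ) * u)) atBot (𝓝 0) := by
    have : Tendsto (fun u : ℝ => (θ - κ) * u) atBot atBot :=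
      tendsto_id.const_mul_atBot (by linarith)
    simpa using (Real.tendsto_exp_atBot.comp this).const_mul C
  refine squeeze_zero_norm' ?_ hl
  filter_upwards [eventually_le_atBot 0] with u hu
  rw [Real.norm_eq_abs, abs_mul, abs_of_pos (Real.exp_pos _)]
  have := hC u
  rw [abs_of_nonpos hu] at this
  calc _ ≤ Real.exp (θ * u) * (C * Real.exp (κ * -u)) :=
        mul_le_mul_of_nonneg_left this (Real.exp_pos _).le
    _ = _ := by
        rw [show (θ - κ) * u = θ * u + κ * -u by ring, Real.exp_add]; ring

theorem ExpGrowth.of_le_sq {κ : ℝ} {g : ℝ → ℝ} {C : ℝ} (hκ : 0 < κ) (hg : Continuous g)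
    (h : ∀ u, |g u| ≤ C * (1 + |u|) ^ 2) : ExpGrowth κ g := by
  have hC0 : 0 ≤ C := by
    have := (abs_nonneg _).trans (h 0)
    simpa using this
  refine ⟨hg, C * (1 + 2 / κ) ^ 2, fun u => (h u).trans ?_⟩
  -- Half the rate is used here because the bound is squared afterwards.
  have h1 : 1 + |u| ≤ (1 + 2 / κ) * Real.exp (κ * |u| / 2) := by
    have := Real.add_one_le_exp (κ * |u| / 2)
    have h2 : 1 ≤ Real.exp (κ * |u| / 2) := Real.one_le_exp (by positivity)
    have h3 : |u| ≤ 2 / κ * Real.exp (κ * |u| / 2) := by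
      rw [div_mul_eq_mul_div, le_div_iff₀ hκ]; linarith
    linarith
  calc C * (1 + |u|) ^ 2 ≤ C * ((1 + 2 / κ) * Real.exp (κ * |u| / 2)) ^ 2 := by gcongr
    _ = C * (1 + 2 / κ) ^ 2 * Real.exp (κ * |u|) := by
        rw [mul_pow, ← Real.exp_nat_mul]
        push_cast
        rw [show (2 : ℝ) * (κ * |u| / 2) = κ * |u| by ring]; ring

/-! ### The Langevin equation along a path -/

/-- The value `∫_{-∞}^0 e^{θ s} dg_s`, integrated by parts. -/
noncomputable def ouPast (θ : ℝ) (g : ℝ → ℝ) : ℝ :=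
  -θ * ∫ s in Iic (0 : ℝ), Real.exp (θ * s) * g s

/-- The value `∫_0^t e^{θ s} dg_s`, integrated by parts. -/
noncomputable def ouXi (θ : ℝ) (g : ℝ → ℝ) (t : ℝ) : ℝ :=
  Real.exp (θ * t) * g t - θ * ∫ s in (0 : ℝ)..t, Real.exp (θ * s) * g s

theorem hasRSIntegral_exp_shift (θ c : ℝ) {g : ℝ → ℝ} (hg : Continuous g) {a b : ℝ}
    (hab : a ≤ b) :
    HasRSIntegral (fun s => Real.exp (-θ * (c - s))) g a b
      (Real.exp (-θ * c) * (Real.exp (θ * b) * g b - Real.exp (θ * a) * g a -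
        θ * ∫ s in a..b, Real.exp (θ * s) * g s)) := by
  have e : ∀ s, Real.exp (-θ * (c - s)) = Real.exp (-θ * c) * Real.exp (θ * s) := fun s => by
    rw [← Real.exp_add]; congr 1; ring
  have hd : ∀ x, HasDerivAt (fun s => Real.exp (-θ * (c - s)))
      (Real.exp (-θ * c) * θ * Real.exp (θ * x)) x := by
    intro x
    simp_rw [e]
    have h1 : HasDerivAt (fun s : ℝ => θ * s) θ x := by
      simpa using (hasDerivAt_id x).const_mul θ
    have := h1.exp.const_mul (Real.exp (-θ * c))
    exact this.congr_deriv (by ring)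
  have := hasRSIntegral_of_hasDerivAt hd (by fun_prop) hg hab
  convert this using 1
  simp_rw [e, mul_assoc]
  rw [intervalIntegral.integral_const_mul, intervalIntegral.integral_const_mul]
  ring

theorem hasRSIntegral_exp (θ : ℝ) {g : ℝ → ℝ} (hg : Continuous g) {a b : ℝ} (hab : a ≤ b) :
    HasRSIntegral (fun s => Real.exp (θ * s)) g a b
      (Real.exp (θ * b) * g b - Real.exp (θ * a) * g a -
        θ * ∫ s in a..b, Real.exp (θ * s) * g s) := by
  simpa using hasRSIntegral_exp_shift θ 0 hg hab

theorem hasRSIntegral_exp_zero {θ : ℝ} {g : ℝ → ℝ} (hg : Continuous g) (h0 : g 0 = 0) {t : ℝ}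
    (ht : 0 ≤ t) : HasRSIntegral (fun s => Real.exp (θ * s)) g 0 t (ouXi θ g t) := by
  simpa [ouXi, h0] using hasRSIntegral_exp θ hg ht

/-- After integration by parts the boundary term at `a` vanishes as `a → -∞` and the remaining
integral converges absolutely, both because `g` grows at a rate below `θ`. -/
theorem hasRSIntegralIic_exp_shift {κ θ : ℝ} {g : ℝ → ℝ} (hκ : 0 ≤ κ) (hκθ : κ < θ)
    (hg : ExpGrowth κ g) (t : ℝ) :
    HasRSIntegralIic (fun s => Real.exp (-θ * (t - s))) g t
      (Real.exp (-θ * t) * (ouPast θ g + ouXi θ g t)) := by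
  refine ⟨_, fun a ha => hasRSIntegral_exp_shift θ t hg.1 ha, ?_⟩
  refine Tendsto.const_mul _ ?_
  have h1 := hg.tendsto_exp_mul hκθ
  have h2 := intervalIntegral_tendsto_integral_Iic t (hg.integrableOn hκ hκθ t) tendsto_id
  have h3 := ((tendsto_const_nhds (x := Real.exp (θ * t) * g t)).sub h1).sub (h2.const_mul θ)
  have h4 := intervalIntegral.integral_Iic_sub_Iic (hg.integrableOn hκ hκθ 0)
    (hg.integrableOn hκ hκθ t)
  have h5 : ouPast θ g + ouXi θ g t = Real.exp (θ * t) * g t - 0 -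
      θ * ∫ s in Iic t, Real.exp (θ * s) * g s := by
    simp only [ouPast, ouXi, ← h4]
    ring
  rw [h5]
  exact h3

theorem hasRSIntegralIic_exp {κ θ : ℝ} {g : ℝ → ℝ} (hκ : 0 ≤ κ) (hκθ : κ < θ)
    (hg : ExpGrowth κ g) (h0 : g 0 = 0) :
    HasRSIntegralIic (fun s => Real.exp (θ * s)) g 0 (ouPast θ g) := by
  simpa [ouXi, h0] using hasRSIntegralIic_exp_shift hκ hκθ hg 0

theorem isLangevinSolution_exp {κ θ : ℝ} {g : ℝ → ℝ} (hκ : 0 ≤ κ) (hκθ : κ < θ)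
    (hg : ExpGrowth κ g) :
    IsLangevinSolution θ g (ouPast θ g)
      (fun t => Real.exp (-θ * t) * (ouPast θ g + ouXi θ g t)) := by
  have hθ : θ ≠ 0 := (hκ.trans_lt hκθ).ne'
  have hc : Continuous fun s => Real.exp (θ * s) * g s := by have := hg.1; fun_prop
  set I : ℝ → ℝ := fun t => ∫ s in (0 : ℝ)..t, Real.exp (θ * s) * g s with hI
  have hI' : ∀ t, HasDerivAt I (Real.exp (θ * t) * g t) t := fun t =>
    intervalIntegral.integral_hasDerivAt_right (hc.intervalIntegrable _ _)
      (hc.stronglyMeasurableAtFilter _ _) hc.continuousAt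
  have hIc : Continuous I := continuous_iff_continuousAt.2 fun t => (hI' t).continuousAt
  have hee : ∀ t, Real.exp (-θ * t) * Real.exp (θ * t) = 1 := fun t => by
    rw [← Real.exp_add]; simp
  -- An explicit primitive of the candidate solution; the boundary terms of the integral in the
  -- equation can then be read off.
  have hW : ∀ t, HasDerivAt (fun t => Real.exp (-θ * t) * (I t - ouPast θ g / θ))
      (Real.exp (-θ * t) * (ouPast θ g + ouXi θ g t)) t := by
    intro t
    have h1 : HasDerivAt (fun s : ℝ => -θ * s) (-θ) t := by
      simpa using (hasDerivAt_id t).const_mul (-θ)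
    have := h1.exp.mul ((hI' t).sub_const (ouPast θ g / θ))
    refine this.congr_deriv ?_
    simp only [ouXi]
    field_simp
    ring
  have hZc : Continuous fun t => Real.exp (-θ * t) * (ouPast θ g + ouXi θ g t) := by
    have h2 : Continuous (ouXi θ g) := by
      have := hg.1
      change Continuous fun t => Real.exp (θ * t) * g t - θ * I t
      fun_prop
    fun_prop
  refine ⟨hZc.continuousOn, fun t _ => ?_⟩
  rw [intervalIntegral.integral_eq_sub_of_hasDerivAt (fun x _ => hW x)
    (hZc.intervalIntegrable _ _)]
  have : I 0 = 0 := by simp [hI]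
  simp only [this, ouXi]
  have h := hee t
  simp only [mul_zero, Real.exp_zero]
  change _ = _ - θ * (_ * (I t - _) - _) + _
  change Real.exp (-θ * t) * (ouPast θ g + (Real.exp (θ * t) * g t - θ * I t)) = _
  have h2 : Real.exp (-θ * t) * (ouPast θ g + (Real.exp (θ * t) * g t - θ * I t)) =
    Real.exp (-θ * t) * ouPast θ g + (Real.exp (-θ * t) * Real.exp (θ * t)) * g t
      - Real.exp (-θ * t) * θ * I t := by ring
  rw [h2, h]
  field_simp
  ring

theorem IsLangevinSolution.unique {θ : ℝ} {g : ℝ → ℝ} {ξ : ℝ} {y z : ℝ → ℝ}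
    (hy : IsLangevinSolution θ g ξ y) (hz : IsLangevinSolution θ g ξ z) {t : ℝ} (ht : 0 ≤ t) :
    y t = z t := by
  obtain ⟨hyc, hy⟩ := hy
  obtain ⟨hzc, hz⟩ := hz
  -- Freezing the solutions at their value at `0` for negative times gives a function continuous on
  -- the whole line, so its primitive has two-sided derivatives.
  set d : ℝ → ℝ := fun s => y (max s 0) - z (max s 0) with hd
  have hmax : Continuous fun s : ℝ => max s 0 := by fun_prop
  have hdc : Continuous d :=
    (hyc.comp_continuous hmax fun s => mem_Ici.2 (le_max_right _ _)).sub
      (hzc.comp_continuous hmax fun s => mem_Ici.2 (le_max_right _ _))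
  set D : ℝ → ℝ := fun t => ∫ s in (0 : ℝ)..t, d s with hD
  have hD' : ∀ t, HasDerivAt D (d t) t := fun t =>
    intervalIntegral.integral_hasDerivAt_right (hdc.intervalIntegrable _ _)
      (hdc.stronglyMeasurableAtFilter _ _) hdc.continuousAt
  have key : ∀ s, 0 ≤ s → d s = -θ * D s := by
    intro s hs
    have hsub : uIcc 0 s ⊆ Ici 0 := by rw [uIcc_of_le hs]; exact fun u hu => hu.1
    have : D s = (∫ u in (0 : ℝ)..s, y u) - ∫ u in (0 : ℝ)..s, z u := by
      rw [← intervalIntegral.integral_sub ((hyc.mono hsub).intervalIntegrable)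
        ((hzc.mono hsub).intervalIntegrable)]
      refine intervalIntegral.integral_congr fun u hu => ?_
      have hu : 0 ≤ u := hsub hu
      simp [hd, max_eq_left hu]
    rw [this]
    simp only [hd, max_eq_left hs]
    rw [hy s hs, hz s hs]; ring
  have hE' : ∀ s, 0 ≤ s → HasDerivAt (fun s => Real.exp (θ * s) * D s) 0 s := by
    intro s hs
    have h1 : HasDerivAt (fun s : ℝ => θ * s) θ s := by
      simpa using (hasDerivAt_id s).const_mul θ
    have := h1.exp.mul (hD' s)
    exact this.congr_deriv (by rw [key s hs]; ring)
  have hconst := constant_of_has_deriv_right_zero (a := 0) (b := t)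
    (fun s hs => (hE' s hs.1).continuousAt.continuousWithinAt)
    (fun s hs => (hE' s hs.1).hasDerivWithinAt) t ⟨ht, le_rfl⟩
  have hDt : D t = 0 := by simpa [hD, Real.exp_ne_zero] using hconst
  have := key t ht
  rw [hDt, mul_zero] at this
  simp only [hd, max_eq_left ht] at this
  linarith

/-! ### Dyadic increments and continuous modifications -/

/-- The largest multiple of `2⁻ⁿ` that is at most `t`. -/
noncomputable def dyadicFloor (n : ℕ) (t : ℝ) : ℝ := (⌊(2 : ℝ) ^ n * t⌋ : ℝ) / 2 ^ n

/-- The increments of `g` over the dyadic intervals of level `n` decay geometrically in `n`, with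
a constant that grows at most linearly. -/
def DyadicHolder (g : ℝ → ℝ) : Prop :=
  ∃ A r : ℝ, 0 ≤ A ∧ 0 ≤ r ∧ r < 1 ∧ ∀ (n : ℕ) (k : ℤ),
    |g ((k + 1) / 2 ^ n) - g (k / 2 ^ n)| ≤ A * (1 + |(k : ℝ)| / 2 ^ n) * r ^ n

theorem dyadicFloor_zero (n : ℕ) : dyadicFloor n 0 = 0 := by simp [dyadicFloor]

theorem dyadicFloor_le (n : ℕ) (t : ℝ) : dyadicFloor n t ≤ t := by
  rw [dyadicFloor, div_le_iff₀ (by positivity), mul_comm]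
  exact Int.floor_le _

theorem lt_dyadicFloor_add (n : ℕ) (t : ℝ) : t < dyadicFloor n t + 1 / 2 ^ n := by
  rw [dyadicFloor, ← add_div, lt_div_iff₀ (by positivity), mul_comm]
  exact Int.lt_floor_add_one _

theorem abs_floor_div_le (n : ℕ) (t : ℝ) : |(⌊(2 : ℝ) ^ n * t⌋ : ℝ)| / 2 ^ n ≤ 1 + |t| := by
  have h1 := dyadicFloor_le n t
  have h2 := lt_dyadicFloor_add n t
  have h3 : (1 : ℝ) / 2 ^ n ≤ 1 := by
    rw [div_le_one (by positivity)]; exact one_le_pow₀ (by norm_num)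
  have h4 : |(⌊(2 : ℝ) ^ n * t⌋ : ℝ)| / 2 ^ n = |dyadicFloor n t| := by
    rw [dyadicFloor, abs_div, abs_of_pos (by positivity : (0 : ℝ) < 2 ^ n)]
  rw [h4, abs_le]
  constructor <;> linarith [neg_abs_le t, le_abs_self t]

/-- Chaining: geometric decay makes the values at the dyadic floors Cauchy, locally uniformly in
`t`. The limit need not be `g`, which is controlled only at dyadic points. Quadratic growth results
from summing unit increments that grow linearly. -/
theorem DyadicHolder.exists_limit {g : ℝ → ℝ} (hg : DyadicHolder g) :
    ∃ f : ℝ → ℝ, Continuous f ∧ (∃ C, ∀ u, |f u| ≤ C * (1 + |u|) ^ 2) ∧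
      ∀ t, Tendsto (fun n => g (dyadicFloor n t)) atTop (𝓝 (f t)) := by
  obtain ⟨A, r, hA, hr0, hr1, hg⟩ := hg
  have near : ∀ (n : ℕ) (s t : ℝ), s ≤ t → t - s ≤ 1 / 2 ^ n →
      |g (dyadicFloor n t) - g (dyadicFloor n s)| ≤ A * (2 + |s|) * r ^ n := by
    intro n s t hst h
    have hp : (0 : ℝ) < 2 ^ n := by positivity
    have hle : ⌊(2 : ℝ) ^ n * s⌋ ≤ ⌊(2 : ℝ) ^ n * t⌋ :=
      Int.floor_le_floor (mul_le_mul_of_nonneg_left hst hp.le)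
    have hlt : ⌊(2 : ℝ) ^ n * t⌋ ≤ ⌊(2 : ℝ) ^ n * s⌋ + 1 := by
      rw [← Int.floor_add_one]
      refine Int.floor_le_floor ?_
      rw [le_div_iff₀ hp] at h
      linarith
    have hb : 0 ≤ A * (2 + |s|) * r ^ n := by positivity
    -- Points at distance at most `2⁻ⁿ` have equal or adjacent floors, so at most one increment
    -- separates them.
    rcases (by omega : ⌊(2 : ℝ) ^ n * t⌋ = ⌊(2 : ℝ) ^ n * s⌋ ∨
      ⌊(2 : ℝ) ^ n * t⌋ = ⌊(2 : ℝ) ^ n * s⌋ + 1) with e | e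
    · simpa [dyadicFloor, e] using hb
    · have := hg n ⌊(2 : ℝ) ^ n * s⌋
      simp only [dyadicFloor, e, Int.cast_add, Int.cast_one]
      refine this.trans ?_
      have := abs_floor_div_le n s
      gcongr A * ?_ * r ^ n
      linarith
  have step : ∀ (t : ℝ) (n : ℕ), dist (g (dyadicFloor n t)) (g (dyadicFloor (n + 1) t))
      ≤ A * (2 + |t|) * r ^ n := by
    intro t n
    have hb : 0 ≤ A * (2 + |t|) * r ^ n := by positivity
    set k := ⌊(2 : ℝ) ^ n * t⌋ with hk
    have h1 : 2 * k ≤ ⌊(2 : ℝ) ^ (n + 1) * t⌋ := by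
      rw [Int.le_floor]
      push_cast
      rw [pow_succ]
      linarith [Int.floor_le ((2 : ℝ) ^ n * t)]
    have h2 : ⌊(2 : ℝ) ^ (n + 1) * t⌋ < 2 * k + 2 := by
      rw [Int.floor_lt]
      push_cast
      rw [pow_succ]
      linarith [Int.lt_floor_add_one ((2 : ℝ) ^ n * t)]
    have e0 : ((2 * k : ℤ) : ℝ) / 2 ^ (n + 1) = k / 2 ^ n := by
      push_cast; rw [pow_succ]; field_simp
    rw [dist_comm, Real.dist_eq]
    -- Refining the level either keeps the dyadic floor or moves it by a single increment of level
    -- `n + 1`.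
    rcases (by omega : ⌊(2 : ℝ) ^ (n + 1) * t⌋ = 2 * k ∨
      ⌊(2 : ℝ) ^ (n + 1) * t⌋ = 2 * k + 1) with e | e
    · simp only [dyadicFloor, e, e0, ← hk, sub_self, abs_zero]; exact hb
    · have h3 := hg (n + 1) (2 * k)
      have h4 := abs_floor_div_le n t
      rw [← hk] at h4
      have e1 : |((2 * k : ℤ) : ℝ)| / 2 ^ (n + 1) = |(k : ℝ)| / 2 ^ n := by
        push_cast; rw [pow_succ, abs_mul, abs_two]; field_simp
      rw [e0, e1] at h3
      simp only [dyadicFloor, e, ← hk]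
      push_cast at h3 ⊢
      refine h3.trans ?_
      have : r ^ (n + 1) ≤ r ^ n := pow_le_pow_of_le_one hr0 hr1.le (Nat.le_succ n)
      gcongr A * ?_ * ?_
      linarith
  have hlim : ∀ t, ∃ y, Tendsto (fun n => g (dyadicFloor n t)) atTop (𝓝 y) := fun t =>
    cauchySeq_tendsto_of_complete (cauchySeq_of_le_geometric r _ hr1 (step t))
  choose f hf using hlim
  have hdist : ∀ t n, |g (dyadicFloor n t) - f t| ≤ A * (2 + |t|) * r ^ n / (1 - r) := fun t n =>
    dist_le_of_le_geometric_of_tendsto r _ hr1 (step t) (hf t) n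
  have h1r : 0 < 1 - r := by linarith
  refine ⟨f, ?_, ?_, hf⟩
  · rw [continuous_iff_continuousAt]
    intro s
    rw [ContinuousAt, Metric.tendsto_nhds]
    intro ε hε
    set M := A * (3 + |s|) * (1 + 2 / (1 - r)) with hM
    have hM0 : 0 ≤ M := by positivity
    have hlim : Tendsto (fun n : ℕ => M * r ^ n) atTop (𝓝 0) := by
      simpa using (tendsto_pow_atTop_nhds_zero_of_lt_one hr0 hr1).const_mul M
    obtain ⟨n, hn⟩ := (hlim.eventually (gt_mem_nhds hε)).exists
    have hn1 : (1 : ℝ) / 2 ^ n ≤ 1 := by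
      rw [div_le_one (by positivity)]; exact one_le_pow₀ (by norm_num)
    filter_upwards [Metric.ball_mem_nhds s (by positivity : (0 : ℝ) < 1 / 2 ^ n)] with t ht
    rw [Metric.mem_ball, Real.dist_eq] at ht
    have hts : |t| ≤ |s| + 1 := by
      have := abs_sub_abs_le_abs_sub t s
      linarith
    have hnear : |g (dyadicFloor n t) - g (dyadicFloor n s)| ≤ A * (3 + |s|) * r ^ n := by
      rcases le_total s t with h | h
      · refine (near n s t h ((le_abs_self _).trans ht.le)).trans ?_
        gcongr
        norm_num
      · rw [abs_sub_comm]
        rw [abs_sub_comm] at ht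
        refine (near n t s h ((le_abs_self _).trans ht.le)).trans ?_
        gcongr ?_ * _
        gcongr ?_ * ?_
        linarith
    have d1 : |g (dyadicFloor n t) - f t| ≤ A * (3 + |s|) * r ^ n / (1 - r) := by
      refine (hdist t n).trans ?_
      gcongr ?_ / _
      gcongr ?_ * _
      gcongr ?_ * ?_
      linarith
    have d2 : |g (dyadicFloor n s) - f s| ≤ A * (3 + |s|) * r ^ n / (1 - r) := by
      refine (hdist s n).trans ?_
      gcongr
      norm_num
    rw [Real.dist_eq]
    calc |f t - f s| = |(g (dyadicFloor n t) - g (dyadicFloor n s)) -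
          (g (dyadicFloor n t) - f t) + (g (dyadicFloor n s) - f s)| := by ring_nf
      _ ≤ |g (dyadicFloor n t) - g (dyadicFloor n s)| + |g (dyadicFloor n t) - f t|
          + |g (dyadicFloor n s) - f s| :=
          (abs_add_le _ _).trans (add_le_add_left (abs_sub _ _) _)
      _ ≤ M * r ^ n := by
          have : M * r ^ n = A * (3 + |s|) * r ^ n + A * (3 + |s|) * r ^ n / (1 - r)
            + A * (3 + |s|) * r ^ n / (1 - r) := by rw [hM]; field_simp; ring
          linarith
      _ < ε := hn
  · have hint : ∀ k : ℤ, |g k| ≤ |g 0| + A * (1 + |(k : ℝ)|) * |(k : ℝ)| := by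
      intro k
      induction k using Int.induction_on with
      | zero => simp
      | succ i ih =>
        have h := hg 0 i
        simp only [pow_zero, div_one, mul_one] at h
        push_cast at h ih ⊢
        rw [Nat.abs_cast] at ih h
        rw [abs_of_nonneg (by positivity : (0 : ℝ) ≤ (i : ℝ) + 1)]
        have h2 := abs_sub_abs_le_abs_sub (g ((i : ℝ) + 1)) (g i)
        have : (0 : ℝ) ≤ i := by positivity
        nlinarith
      | pred i ih =>
        have h := hg 0 (-i - 1)
        simp only [pow_zero, div_one, mul_one] at h
        push_cast at h ih ⊢
        have e1 : |(-(i : ℝ) - 1)| = i + 1 := by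
          rw [abs_of_nonpos (by linarith [(by positivity : (0 : ℝ) ≤ i)])]; ring
        rw [abs_neg, Nat.abs_cast] at ih
        rw [e1, sub_add_cancel] at h
        rw [e1]
        rw [abs_sub_comm] at h
        have h2 := abs_sub_abs_le_abs_sub (g (-(i : ℝ) - 1)) (g (-i))
        have : (0 : ℝ) ≤ i := by positivity
        nlinarith
    refine ⟨|g 0| + 4 * A + 2 * A / (1 - r), fun u => ?_⟩
    have h0 := hdist u 0
    have h1 := hint ⌊u⌋
    have h2 : |(⌊u⌋ : ℝ)| ≤ 1 + |u| := by simpa using abs_floor_div_le 0 u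
    have h3 : dyadicFloor 0 u = ⌊u⌋ := by simp [dyadicFloor]
    rw [h3, pow_zero, mul_one, abs_sub_comm] at h0
    have h4 := abs_sub_abs_le_abs_sub (f u) (g ⌊u⌋)
    have hu := abs_nonneg u
    have h5 : A * (1 + |(⌊u⌋ : ℝ)|) * |(⌊u⌋ : ℝ)| ≤ A * (2 + |u|) * (1 + |u|) :=
      mul_le_mul (mul_le_mul_of_nonneg_left (by linarith) hA) h2 (abs_nonneg _) (by positivity)
    have h6 : A * (2 + |u|) / (1 - r) ≤ 2 * A / (1 - r) * (1 + |u|) ^ 2 := by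
      rw [div_mul_eq_mul_div]
      gcongr ?_ / _
      nlinarith [mul_nonneg hA hu, mul_nonneg hA (sq_nonneg |u|)]
    have h7 : A * (2 + |u|) * (1 + |u|) ≤ 4 * A * (1 + |u|) ^ 2 := by
      nlinarith [mul_nonneg hA hu, mul_nonneg hA (sq_nonneg |u|)]
    have h8 : |g 0| ≤ |g 0| * (1 + |u|) ^ 2 :=
      le_mul_of_one_le_right (abs_nonneg _) (by nlinarith)
    have : (|g 0| + 4 * A + 2 * A / (1 - r)) * (1 + |u|) ^ 2 = |g 0| * (1 + |u|) ^ 2 +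
      4 * A * (1 + |u|) ^ 2 + 2 * A / (1 - r) * (1 + |u|) ^ 2 := by ring
    linarith

/-! ### Kolmogorov's continuity theorem on the line -/

section Kolmogorov

variable {Ω : Type*} [MeasurableSpace Ω] {P : Measure Ω} {G : ℝ → Ω → ℝ}

theorem summable_inv_one_add_abs_int_sq : Summable fun k : ℤ => 1 / (1 + |(k : ℝ)|) ^ 2 := by
  have h := Real.summable_one_div_nat_pow.2 (one_lt_two)
  have h1 : Summable fun n : ℕ => 1 / (1 + (n : ℝ)) ^ 2 := by
    have := (summable_nat_add_iff 1).2 h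
    refine this.congr fun n => ?_
    push_cast
    rw [add_comm]
  refine Summable.of_nat_of_neg ?_ ?_
  · simpa using h1
  · simpa using h1

theorem half_rpow_pow_comm (q : ℝ) (n : ℕ) :
    (((1 : ℝ) / 2) ^ (1 / q)) ^ n = ((1 / 2) ^ n) ^ (1 / q) := by
  rw [← Real.rpow_natCast, ← Real.rpow_natCast, ← Real.rpow_mul (by norm_num),
    ← Real.rpow_mul (by norm_num), mul_comm]

/-- Finiteness of the moments weighted over all dyadic intervals. -/
theorem lintegral_dyadic_increments_ne_top (hG : ∀ t, Measurable (G t)) {q c : ℝ}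
    (h : ∀ s t : ℝ, ∫⁻ ω, ENNReal.ofReal (|G t ω - G s ω| ^ q) ∂P
      ≤ ENNReal.ofReal (c * |t - s| ^ (4 : ℝ))) :
    ∫⁻ ω, ∑' p : ℕ × ℤ, ENNReal.ofReal (8 ^ p.1 / (1 + |(p.2 : ℝ)|) ^ 2 *
      |G ((p.2 + 1) / 2 ^ p.1) ω - G (p.2 / 2 ^ p.1) ω| ^ q) ∂P ≠ ⊤ := by
  rw [lintegral_tsum (fun p => by
    have h1 := hG (((p.2 : ℝ) + 1) / 2 ^ p.1)
    have h2 := hG ((p.2 : ℝ) / 2 ^ p.1)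
    fun_prop)]
  have hs : Summable fun p : ℕ × ℤ => c * ((1 / 2 : ℝ) ^ p.1 * (1 / (1 + |(p.2 : ℝ)|) ^ 2)) :=
    ((summable_geometric_two).mul_of_nonneg summable_inv_one_add_abs_int_sq
      (fun n => by positivity) (fun k => by positivity)).mul_left c
  refine ne_top_of_le_ne_top hs.tsum_ofReal_ne_top (ENNReal.tsum_le_tsum fun p => ?_)
  obtain ⟨n, k⟩ := p
  have h0 : (0 : ℝ) ≤ 8 ^ n / (1 + |(k : ℝ)|) ^ 2 := by positivity
  simp_rw [ENNReal.ofReal_mul h0]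
  rw [lintegral_const_mul' _ _ ENNReal.ofReal_ne_top]
  calc _ ≤ ENNReal.ofReal (8 ^ n / (1 + |(k : ℝ)|) ^ 2) *
        ENNReal.ofReal (c * |((k : ℝ) + 1) / 2 ^ n - k / 2 ^ n| ^ (4 : ℝ)) := by gcongr; exact h _ _
    _ = _ := by
        rw [← ENNReal.ofReal_mul h0]
        congr 1
        have : ((k : ℝ) + 1) / 2 ^ n - k / 2 ^ n = (1 / 2) ^ n := by
          rw [one_div_pow]; field_simp; ring
        rw [this, abs_of_pos (by positivity : (0 : ℝ) < (1 / 2) ^ n), show (4 : ℝ) = ((4 : ℕ) : ℝ) by norm_num,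
          Real.rpow_natCast, ← pow_mul]
        -- The fourth-power bound gives `16⁻ⁿ`; against the weight `8 ^ n` a summable `2⁻ⁿ` remains.
        have e8 : (8 : ℝ) ^ n * (1 / 2) ^ (n * 4) = (1 / 2) ^ n := by
          rw [mul_comm n 4, pow_mul, ← mul_pow]; norm_num
        rw [← e8]; ring

/-- An almost surely finite weighted sum dominates each of its terms. This bounds the `q`-th power
of an increment by a multiple of `(1 + |k|) ^ 2 * 8⁻ⁿ`, hence of `(1 + |k| / 2ⁿ) ^ 2 * 2⁻ⁿ`. Taking
`q`-th roots with `q ≥ 2` leaves at most linear growth and the ratio `2 ^ (-1 / q)`. -/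
theorem ae_dyadicHolder (hG : ∀ t, Measurable (G t)) {q c : ℝ} (hq : 2 ≤ q)
    (h : ∀ s t : ℝ, ∫⁻ ω, ENNReal.ofReal (|G t ω - G s ω| ^ q) ∂P
      ≤ ENNReal.ofReal (c * |t - s| ^ (4 : ℝ))) :
    ∀ᵐ ω ∂P, DyadicHolder fun t => G t ω := by
  have hfin := ae_lt_top' (Measurable.tsum fun p : ℕ × ℤ => by
    have h1 := hG (((p.2 : ℝ) + 1) / 2 ^ p.1)
    have h2 := hG ((p.2 : ℝ) / 2 ^ p.1)
    fun_prop).aemeasurable (lintegral_dyadic_increments_ne_top hG h)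
  filter_upwards [hfin] with ω hω
  have hq0 : 0 < q := by linarith
  set S := ∑' p : ℕ × ℤ, ENNReal.ofReal (8 ^ p.1 / (1 + |(p.2 : ℝ)|) ^ 2 *
      |G ((p.2 + 1) / 2 ^ p.1) ω - G (p.2 / 2 ^ p.1) ω| ^ q)
  -- Adding one makes the constant at least `1`, so that its `q`-th power still dominates the sum.
  refine ⟨S.toReal + 1, (1 / 2) ^ (1 / q), by positivity, by positivity,
    Real.rpow_lt_one (by norm_num) (by norm_num) (by positivity), fun n k => ?_⟩
  have h1 : ENNReal.ofReal (8 ^ n / (1 + |(k : ℝ)|) ^ 2 *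
      |G ((k + 1) / 2 ^ n) ω - G (k / 2 ^ n) ω| ^ q) ≤ S := ENNReal.le_tsum (n, k)
  have h2 := (ENNReal.ofReal_le_iff_le_toReal hω.ne).1 h1
  set D := |G ((k + 1) / 2 ^ n) ω - G (k / 2 ^ n) ω|
  set B := S.toReal
  have hB : 0 ≤ B := ENNReal.toReal_nonneg
  have hD : 0 ≤ D := abs_nonneg _
  set y : ℝ := 1 + |(k : ℝ)| / 2 ^ n with hy
  have hy1 : 1 ≤ y := by rw [hy]; linarith [(by positivity : 0 ≤ |(k : ℝ)| / 2 ^ n)]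
  have hky : 1 + |(k : ℝ)| ≤ 2 ^ n * y := by
    rw [hy, mul_add, mul_div_cancel₀ _ (by positivity)]
    have : (1 : ℝ) ≤ 2 ^ n := one_le_pow₀ (by norm_num)
    linarith
  have h3 : D ^ q ≤ B * y ^ 2 * (1 / 2) ^ n := by
    rw [div_mul_eq_mul_div, div_le_iff₀ (by positivity)] at h2
    have h4 : (8 : ℝ) ^ n * D ^ q ≤ B * (2 ^ n * y) ^ 2 := h2.trans (by gcongr)
    have e : (8 : ℝ) ^ n * (1 / 2) ^ n = (2 ^ n) ^ 2 := by
      rw [← mul_pow, ← pow_mul, mul_comm n 2, pow_mul]; norm_num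
    have h5 : (8 : ℝ) ^ n * D ^ q ≤ 8 ^ n * (B * y ^ 2 * (1 / 2) ^ n) := by
      calc _ ≤ _ := h4
        _ = B * y ^ 2 * (2 ^ n) ^ 2 := by ring
        _ = _ := by rw [← e]; ring
    exact le_of_mul_le_mul_left h5 (by positivity)
  rw [half_rpow_pow_comm, ← Real.rpow_le_rpow_iff hD (by positivity) hq0,
    Real.mul_rpow (by positivity) (by positivity), Real.mul_rpow (by positivity) (by positivity),
    ← Real.rpow_mul (by positivity), one_div_mul_cancel hq0.ne', Real.rpow_one]
  refine h3.trans ?_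
  gcongr
  · calc B ≤ B + 1 := by linarith
      _ = (B + 1) ^ (1 : ℝ) := (Real.rpow_one _).symm
      _ ≤ (B + 1) ^ q := Real.rpow_le_rpow_of_exponent_le (by linarith) (by linarith)
  · rw [← Real.rpow_natCast]
    exact Real.rpow_le_rpow_of_exponent_le hy1 (by exact_mod_cast hq)

/-- This identifies the chaining limit with `G t` for each fixed `t`: the `q`-th moments of the
differences are summable, so the differences tend to `0` almost surely. -/
theorem ae_tendsto_dyadicFloor (hG : ∀ t, Measurable (G t)) {q c : ℝ} (hq : 2 ≤ q) (hc : 0 ≤ c)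
    (h : ∀ s t : ℝ, ∫⁻ ω, ENNReal.ofReal (|G t ω - G s ω| ^ q) ∂P
      ≤ ENNReal.ofReal (c * |t - s| ^ (4 : ℝ))) (t : ℝ) :
    ∀ᵐ ω ∂P, Tendsto (fun n => G (dyadicFloor n t) ω) atTop (𝓝 (G t ω)) := by
  have hm : ∀ n, Measurable fun ω => ENNReal.ofReal (|G (dyadicFloor n t) ω - G t ω| ^ q) :=
    fun n => by
      have h1 := hG (dyadicFloor n t)
      have h2 := hG t
      fun_prop
  have hfin : ∫⁻ ω, ∑' n, ENNReal.ofReal (|G (dyadicFloor n t) ω - G t ω| ^ q) ∂P ≠ ⊤ := by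
    rw [lintegral_tsum fun n => (hm n).aemeasurable]
    refine ne_top_of_le_ne_top (summable_geometric_two.mul_left c).tsum_ofReal_ne_top
      (ENNReal.tsum_le_tsum fun n => (h _ _).trans (ENNReal.ofReal_le_ofReal ?_))
    gcongr
    have h1 := dyadicFloor_le n t
    have h2 := lt_dyadicFloor_add n t
    have h3 : |dyadicFloor n t - t| ≤ (1 / 2) ^ n := by
      rw [one_div_pow, abs_le]; constructor <;> linarith [(by positivity : (0:ℝ) < 1 / 2 ^ n)]
    have h4 : ((1 : ℝ) / 2) ^ n ≤ 1 := pow_le_one₀ (by norm_num) (by norm_num)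
    calc |dyadicFloor n t - t| ^ (4 : ℝ) ≤ |dyadicFloor n t - t| ^ (1 : ℝ) := by
          rcases (abs_nonneg (dyadicFloor n t - t)).eq_or_lt with h5 | h5
          · rw [← h5]; simp
          · exact Real.rpow_le_rpow_of_exponent_ge h5 (h3.trans h4) (by norm_num)
      _ ≤ _ := by rwa [Real.rpow_one]
  filter_upwards [ae_lt_top' (Measurable.tsum hm).aemeasurable hfin] with ω hω
  have h0 := ENNReal.tendsto_atTop_zero_of_tsum_ne_top hω.ne
  have h1 : Tendsto (fun n => |G (dyadicFloor n t) ω - G t ω| ^ q) atTop (𝓝 0) := by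
    have := (ENNReal.tendsto_toReal ENNReal.zero_ne_top).comp h0
    refine this.congr fun n => ?_
    exact ENNReal.toReal_ofReal (by positivity)
  have hq0 : 0 < q := by linarith
  have h2 : Tendsto (fun n => |G (dyadicFloor n t) ω - G t ω|) atTop (𝓝 0) := by
    have := h1.rpow_const (p := 1 / q) (Or.inr (by positivity))
    rw [Real.zero_rpow (by positivity)] at this
    refine this.congr fun n => ?_
    rw [← Real.rpow_mul (abs_nonneg _), mul_one_div_cancel hq0.ne', Real.rpow_one]
  exact tendsto_iff_dist_tendsto_zero.2 h2

theorem IncrementMomentAssumption.exists_fourth (hA : IncrementMomentAssumption G P) :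
    ∃ q c : ℝ, 2 ≤ q ∧ 0 ≤ c ∧ ∀ s t : ℝ, ∫⁻ ω, ENNReal.ofReal (|G t ω - G s ω| ^ q) ∂P
      ≤ ENNReal.ofReal (c * |t - s| ^ (4 : ℝ)) := by
  obtain ⟨-, γ, h0, h1, h⟩ := hA
  have hq : 2 ≤ 4 / γ := by rw [le_div_iff₀ h0]; linarith
  obtain ⟨c, hc, hb⟩ := h (4 / γ) hq
  exact ⟨_, c, hq, hc.le, by simpa [h0.ne'] using hb⟩

/-- A version all of whose paths are continuous, start at `0` and grow at most quadratically. -/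
theorem exists_regular_version (hG : ∀ t, Measurable (G t))
    (hA : IncrementMomentAssumption G P) :
    ∃ H : ℝ → Ω → ℝ, (∀ t, Measurable (H t)) ∧ (∀ ω, Continuous fun t => H t ω) ∧
      (∀ ω, H 0 ω = 0) ∧ (∀ ω, ∃ C, ∀ u, |H u ω| ≤ C * (1 + |u|) ^ 2) ∧
      ∀ t, H t =ᵐ[P] G t := by
  classical
  obtain ⟨q, c, hq, hc, h⟩ := hA.exists_fourth
  have hgood : ∀ᵐ ω ∂P, (DyadicHolder fun t => G t ω) ∧ G 0 ω = 0 :=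
    (ae_dyadicHolder hG hq h).and hA.1
  -- The exceptional set is enlarged to a measurable one, so that setting paths to zero on it
  -- preserves measurability.
  obtain ⟨N, hN, hNm, hN0⟩ := exists_measurable_superset_of_null (ae_iff.1 hgood)
  set A := Nᶜ
  have hAm : MeasurableSet A := hNm.compl
  have hAP : ∀ᵐ ω ∂P, ω ∈ A := measure_eq_zero_iff_ae_notMem.1 hN0
  have hAg : ∀ ω ∈ A, (DyadicHolder fun t => G t ω) ∧ G 0 ω = 0 :=
    fun ω hω => not_not.1 fun hn => hω (hN hn)
  have key : ∀ ω : A, ∃ f : ℝ → ℝ, Continuous f ∧ (∃ C, ∀ u, |f u| ≤ C * (1 + |u|) ^ 2) ∧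
      ∀ t, Tendsto (fun n => G (dyadicFloor n t) ω) atTop (𝓝 (f t)) :=
    fun ω => (hAg ω ω.2).1.exists_limit
  choose f hfc hfg hfl using key
  refine ⟨fun t ω => if hω : ω ∈ A then f ⟨ω, hω⟩ t else 0, fun t => ?_, fun ω => ?_, fun ω => ?_,
    fun ω => ?_, fun t => ?_⟩
  · refine measurable_of_tendsto_metrizable
      (f := fun n => A.indicator (G (dyadicFloor n t))) (fun n => (hG _).indicator hAm) ?_
    rw [tendsto_pi_nhds]
    intro ω
    by_cases hω : ω ∈ A
    · simpa [hω] using hfl ⟨ω, hω⟩ t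
    · simp [hω]
  · by_cases hω : ω ∈ A
    · simpa [hω] using hfc ⟨ω, hω⟩
    · simpa [hω] using continuous_const
  · by_cases hω : ω ∈ A
    · simp only [hω, dif_pos]
      refine tendsto_nhds_unique (hfl ⟨ω, hω⟩ 0) ?_
      simp [dyadicFloor_zero, (hAg ω hω).2]
    · simp [hω]
  · by_cases hω : ω ∈ A
    · simpa [hω] using hfg ⟨ω, hω⟩
    · exact ⟨0, by simp [hω]⟩
  · filter_upwards [ae_tendsto_dyadicFloor hG hq hc h t, hAP] with ω h1 hω
    simp only [hω, dif_pos]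
    exact tendsto_nhds_unique (hfl ⟨ω, hω⟩ t) h1

theorem ae_forall_eq_of_continuous {H K : ℝ → Ω → ℝ} (hH : ∀ᵐ ω ∂P, Continuous fun t => H t ω)
    (hK : ∀ᵐ ω ∂P, Continuous fun t => K t ω) (h : ∀ t, H t =ᵐ[P] K t) :
    ∀ᵐ ω ∂P, ∀ t, H t ω = K t ω := by
  have hQ : ∀ᵐ ω ∂P, ∀ r : ℚ, H r ω = K r ω := ae_all_iff.2 fun r => h r
  filter_upwards [hH, hK, hQ] with ω h1 h2 h3 t
  exact congrFun (Rat.isDenseEmbedding_coe_real.dense.equalizer h1 h2 (funext h3)) t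

end Kolmogorov

/-! ### Stationarity -/

theorem HasRSIntegralIic.hasRSIntegral_rsIntegral {f g : ℝ → ℝ} {b I : ℝ}
    (h : HasRSIntegralIic f g b I) {a : ℝ} (ha : a ≤ b) :
    HasRSIntegral f g a b (rsIntegral f g a b) := by
  obtain ⟨J, hJ, -⟩ := h
  rw [(hJ a ha).rsIntegral_eq]
  exact hJ a ha

theorem HasRSIntegralIic.tendsto_rsIntegral {f g : ℝ → ℝ} {b I : ℝ}
    (h : HasRSIntegralIic f g b I) : Tendsto (fun a => rsIntegral f g a b) atBot (𝓝 I) := by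
  obtain ⟨J, hJ, hI⟩ := h
  refine hI.congr' ?_
  filter_upwards [eventually_le_atBot b] with a ha using (hJ a ha).rsIntegral_eq.symm

/-- The kernel sees only the lag, so shifting the interval by `h` shifts the partition points and
nothing else. Subtracting `g h` is free in increments and produces exactly the variables of the
stationarity hypothesis. -/
theorem uniformRSSum_exp_shift (θ t h N : ℝ) (g : ℝ → ℝ) (m : ℕ) :
    uniformRSSum (fun s => Real.exp (-θ * (t + h - s))) g (t + h - N) (t + h) m =
      ∑ j : Fin (m + 1), Real.exp (-θ * (t - uniformPoint (t - N) t m j)) *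
        ((g (uniformPoint (t - N) t m (j + 1) + h) - g h) -
          (g (uniformPoint (t - N) t m j + h) - g h)) := by
  have e : ∀ j, uniformPoint (t + h - N) (t + h) m j = uniformPoint (t - N) t m j + h := by
    intro j; simp only [uniformPoint]; ring
  rw [uniformRSSum, Finset.sum_range]
  refine Finset.sum_congr rfl fun j _ => ?_
  rw [e, e, sub_sub_sub_cancel_right]
  congr 3
  ring

section Stationarity

variable {Ω : Type*} [MeasurableSpace Ω] {P : Measure Ω}

/-- Laws are determined by bounded continuous test functions, whose expectations pass to the limit
by dominated convergence. Measurability of the limits comes along, so none has to be shown for `ouZ`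
beforehand. -/
theorem IdentDistrib.of_tendsto_ae [IsProbabilityMeasure P] {n : ℕ} {f g : ℕ → Ω → Fin n → ℝ} {F K : Ω → Fin n → ℝ}
    (h : ∀ m, IdentDistrib (f m) (g m) P P)
    (hf : ∀ᵐ ω ∂P, Tendsto (fun m => f m ω) atTop (𝓝 (F ω)))
    (hg : ∀ᵐ ω ∂P, Tendsto (fun m => g m ω) atTop (𝓝 (K ω))) : IdentDistrib F K P P := by
  have hF : AEMeasurable F P :=
    aemeasurable_of_tendsto_metrizable_ae atTop (fun m => (h m).aemeasurable_fst) hf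
  have hK : AEMeasurable K P :=
    aemeasurable_of_tendsto_metrizable_ae atTop (fun m => (h m).aemeasurable_snd) hg
  refine ⟨hF, hK, ?_⟩
  have := Measure.isProbabilityMeasure_map hF
  have := Measure.isProbabilityMeasure_map hK
  refine ext_of_forall_integral_eq_of_IsFiniteMeasure fun φ => ?_
  have lim : ∀ {u : ℕ → Ω → Fin n → ℝ} {U : Ω → Fin n → ℝ}, (∀ m, AEMeasurable (u m) P) →
      (∀ᵐ ω ∂P, Tendsto (fun m => u m ω) atTop (𝓝 (U ω))) →
      Tendsto (fun m => ∫ ω, φ (u m ω) ∂P) atTop (𝓝 (∫ ω, φ (U ω) ∂P)) := by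
    intro u U hu hU
    refine tendsto_integral_of_dominated_convergence (fun _ => ‖φ‖)
      (fun m => φ.continuous.comp_aestronglyMeasurable (hu m).aestronglyMeasurable)
      (integrable_const _) (fun m => ae_of_all _ fun ω => φ.norm_coe_le_norm _) ?_
    filter_upwards [hU] with ω hω using (φ.continuous.tendsto _).comp hω
  rw [integral_map hF φ.continuous.aestronglyMeasurable,
    integral_map hK φ.continuous.aestronglyMeasurable]
  refine tendsto_nhds_unique (lim (fun m => (h m).aemeasurable_fst) hf)
    ((lim (fun m => (h m).aemeasurable_snd) hg).congr fun m => ?_)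
  exact ((h m).comp φ.continuous.measurable).integral_eq.symm

variable {H : ℝ → Ω → ℝ}

theorem HasStationaryIncrements.congr {G H : ℝ → Ω → ℝ} (hG : HasStationaryIncrements G P)
    (h : ∀ t, H t =ᵐ[P] G t) : HasStationaryIncrements H P := by
  intro s n τ
  have e1 : (fun ω (i : Fin n) => G (τ i) ω - G 0 ω) =ᵐ[P] fun ω i => H (τ i) ω - H 0 ω := by
    filter_upwards [ae_all_iff.2 fun i => h (τ i), h 0] with ω h1 h2
    funext i
    rw [h1 i, h2]
  have e2 : (fun ω (i : Fin n) => G (τ i + s) ω - G s ω)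
      =ᵐ[P] fun ω i => H (τ i + s) ω - H s ω := by
    filter_upwards [ae_all_iff.2 fun i => h (τ i + s), h s] with ω h1 h2
    funext i
    rw [h1 i, h2]
  have := hG s n τ
  exact ((IdentDistrib.of_ae_eq this.aemeasurable_fst e1).symm.trans this).trans
    (IdentDistrib.of_ae_eq this.aemeasurable_snd e2)

theorem HasStationaryIncrements.identDistrib {ι : Type*} [Fintype ι]
    (hH : HasStationaryIncrements H P) (s : ℝ) (τ : ι → ℝ) :
    IdentDistrib (fun ω i => H (τ i) ω - H 0 ω) (fun ω i => H (τ i + s) ω - H s ω) P P := by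
  let e := Fintype.equivFin ι
  have h := hH s (Fintype.card ι) (τ ∘ e.symm)
  have hm : Measurable fun (y : Fin (Fintype.card ι) → ℝ) (i : ι) => y (e i) := by fun_prop
  simpa [Function.comp_def] using h.comp hm

theorem HasStationaryIncrements.identDistrib_uniformRSSum
    (hH : HasStationaryIncrements H P) (θ h : ℝ) {n : ℕ} (τ : Fin n → ℝ) (N : ℝ) (m : ℕ) :
    IdentDistrib
      (fun ω i => uniformRSSum (fun s => Real.exp (-θ * (τ i + h - s))) (fun s => H s ω)
        (τ i + h - N) (τ i + h) m)
      (fun ω i => uniformRSSum (fun s => Real.exp (-θ * (τ i - s))) (fun s => H s ω)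
        (τ i - N) (τ i) m) P P := by
  -- All partition points of all `n` sums are treated jointly; `m + 1` intervals need `m + 2`
  -- points.
  have key := hH.identDistrib h
    (fun p : Fin n × Fin (m + 2) => uniformPoint (τ p.1 - N) (τ p.1) m p.2)
  have hm : Measurable fun (y : Fin n × Fin (m + 2) → ℝ) (i : Fin n) =>
      ∑ j : Fin (m + 1), Real.exp (-θ * (τ i - uniformPoint (τ i - N) (τ i) m j)) *
        (y (i, j.succ) - y (i, j.castSucc)) := by fun_prop
  have h0 := fun ω i => uniformRSSum_exp_shift θ (τ i) 0 N (fun s => H s ω) m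
  simp only [add_zero] at h0
  simp_rw [uniformRSSum_exp_shift, h0]
  simpa [Function.comp_def] using (key.comp hm).symm

theorem HasStationaryIncrements.isStationaryProcess_ouZ [IsProbabilityMeasure P]
    (hH : HasStationaryIncrements H P)
    {θ : ℝ} (hex : ∀ᵐ ω ∂P, ∀ t, ∃ I, HasRSIntegralIic (fun s => Real.exp (-θ * (t - s)))
      (fun s => H s ω) t I) : IsStationaryProcess (ouZ θ H) P := by
  intro h _ n τ _
  have hZ : ∀ᵐ ω ∂P, ∀ t, HasRSIntegralIic (fun s => Real.exp (-θ * (t - s)))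
      (fun s => H s ω) t (ouZ θ H t ω) := by
    filter_upwards [hex] with ω hω t
    obtain ⟨I, hI⟩ := hω t
    rw [ouZ, hI.rsIntegralIic_eq]
    exact hI
  have lim1 : ∀ N : ℕ, ∀ σ : Fin n → ℝ, ∀ᵐ ω ∂P,
      Tendsto (fun m i => uniformRSSum (fun s => Real.exp (-θ * (σ i - s))) (fun s => H s ω)
        (σ i - N) (σ i) m) atTop (𝓝 fun i => rsIntegral (fun s => Real.exp (-θ * (σ i - s)))
          (fun s => H s ω) (σ i - N) (σ i)) := by
    intro N σ
    filter_upwards [hZ] with ω hω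
    rw [tendsto_pi_nhds]
    exact fun i => ((hω (σ i)).hasRSIntegral_rsIntegral
      (sub_le_self _ (Nat.cast_nonneg N))).tendsto_uniformRSSum
  have lim2 : ∀ σ : Fin n → ℝ, ∀ᵐ ω ∂P,
      Tendsto (fun (N : ℕ) i => rsIntegral (fun s => Real.exp (-θ * (σ i - s)))
          (fun s => H s ω) (σ i - N) (σ i)) atTop (𝓝 fun i => ouZ θ H (σ i) ω) := by
    intro σ
    filter_upwards [hZ] with ω hω
    rw [tendsto_pi_nhds]
    intro i
    refine (hω (σ i)).tendsto_rsIntegral.comp ?_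
    exact tendsto_atBot_add_const_left _ _ (tendsto_neg_atTop_atBot.comp tendsto_natCast_atTop_atTop)
  exact IdentDistrib.of_tendsto_ae (fun N => IdentDistrib.of_tendsto_ae
    (fun m => hH.identDistrib_uniformRSSum θ h τ N m) (lim1 N fun i => τ i + h) (lim1 N τ))
    (lim2 fun i => τ i + h) (lim2 τ)

end Stationarity

/-! ### Convolution with an exponential weight -/

theorem ExpGrowth.mul {κ κ' : ℝ} {f g : ℝ → ℝ} (hf : ExpGrowth κ f) (hg : ExpGrowth κ' g) :
    ExpGrowth (κ + κ') fun u => f u * g u := by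
  obtain ⟨hfc, C, hC⟩ := hf
  obtain ⟨hgc, D, hD⟩ := hg
  refine ⟨hfc.mul hgc, C * D, fun u => ?_⟩
  rw [abs_mul, add_mul, Real.exp_add]
  calc |f u| * |g u| ≤ (C * Real.exp (κ * |u|)) * (D * Real.exp (κ' * |u|)) :=
        mul_le_mul (hC u) (hD u) (abs_nonneg _) ((abs_nonneg _).trans (hC u))
    _ = _ := by ring

/-- The bound is a product in `v` and `u`, which is what makes the double integrals absolutely
convergent. -/
theorem ExpGrowth.bound_sub {κ : ℝ} {g : ℝ → ℝ} (hκ : 0 ≤ κ) (hg : ExpGrowth κ g) :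
    ∃ C, 0 ≤ C ∧ ∀ v u, |g (v - u)| ≤ C * (Real.exp (κ * |v|) * Real.exp (κ * |u|)) := by
  obtain ⟨-, C, hC⟩ := hg
  have hC0 : 0 ≤ C := by
    have := (abs_nonneg _).trans (hC 0)
    simpa using this
  refine ⟨C, hC0, fun v u => (hC _).trans ?_⟩
  rw [← Real.exp_add, ← mul_add]
  gcongr
  exact abs_sub v u

theorem ExpGrowth.comp_sub_left {κ : ℝ} {g : ℝ → ℝ} (hκ : 0 ≤ κ) (hg : ExpGrowth κ g) (v : ℝ) :
    ExpGrowth κ fun u => g (v - u) := by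
  obtain ⟨C, -, hC⟩ := hg.bound_sub hκ
  have := hg.1
  exact ⟨by fun_prop, C * Real.exp (κ * |v|), fun u => (hC v u).trans_eq (by ring)⟩

theorem expGrowth_exp_mul_abs (κ : ℝ) : ExpGrowth κ fun u => Real.exp (κ * |u|) :=
  ⟨by fun_prop, 1, fun u => by simp⟩

/-- `∫_S e^{θ u} ρ (v - u) du`. -/
noncomputable def expConv (θ : ℝ) (ρ : ℝ → ℝ) (S : Set ℝ) (v : ℝ) : ℝ :=
  ∫ u in S, Real.exp (θ * u) * ρ (v - u)

/-- `e^{θ t} ρ (t - u) - e^{θ s} ρ (s - u) - θ ∫_s^t e^{θ v} ρ (v - u) dv`. -/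
noncomputable def expIncr (θ : ℝ) (ρ : ℝ → ℝ) (s t u : ℝ) : ℝ :=
  Real.exp (θ * t) * ρ (t - u) - Real.exp (θ * s) * ρ (s - u) -
    θ * ∫ v in s..t, Real.exp (θ * v) * ρ (v - u)

section Deterministic

variable {κ θ T : ℝ} {ρ : ℝ → ℝ} {S : Set ℝ}

theorem ExpGrowth.integrable_prod (hκ : 0 ≤ κ) (hκθ : κ < θ) (hρ : ExpGrowth κ ρ)
    (hST : S ⊆ Iic T) (s t : ℝ) :
    Integrable (Function.uncurry fun u v => Real.exp (θ * u) * (Real.exp (θ * v) * ρ (v - u)))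
      ((volume.restrict S).prod (volume.restrict (Ioc s t))) := by
  obtain ⟨C, hC0, hC⟩ := hρ.bound_sub hκ
  have h1 : IntegrableOn (fun u => Real.exp (θ * u) * Real.exp (κ * |u|)) S :=
    ((expGrowth_exp_mul_abs κ).integrableOn hκ hκθ T).mono_set hST
  have h2 : IntegrableOn (fun u => Real.exp (θ * u) * Real.exp (κ * |u|)) (Ioc s t) :=
    ((expGrowth_exp_mul_abs κ).integrableOn hκ hκθ t).mono_set fun u hu => hu.2
  have hc := hρ.1
  refine ((Integrable.mul_prod h1 h2).const_mul C).mono' ?_ (ae_of_all _ fun p => ?_)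
  · exact Continuous.aestronglyMeasurable (by unfold Function.uncurry; fun_prop)
  · simp only [Function.uncurry, norm_mul, Real.norm_eq_abs, Real.abs_exp]
    calc _ ≤ Real.exp (θ * p.1) * (Real.exp (θ * p.2) *
          (C * (Real.exp (κ * |p.2|) * Real.exp (κ * |p.1|)))) := by gcongr; exact hC _ _
      _ = _ := by ring

theorem ExpGrowth.expConv_bound (hκ : 0 ≤ κ) (hκθ : κ < θ) (hρ : ExpGrowth κ ρ)
    (hST : S ⊆ Iic T) : ∃ C, ∀ v, |expConv θ ρ S v| ≤ C * Real.exp (κ * |v|) := by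
  obtain ⟨C, hC0, hC⟩ := hρ.bound_sub hκ
  have h1 : IntegrableOn (fun u => Real.exp (θ * u) * Real.exp (κ * |u|)) S :=
    ((expGrowth_exp_mul_abs κ).integrableOn hκ hκθ T).mono_set hST
  refine ⟨C * ∫ u in S, Real.exp (θ * u) * Real.exp (κ * |u|), fun v => ?_⟩
  have h2 := norm_integral_le_of_norm_le (f := fun u => Real.exp (θ * u) * ρ (v - u))
    (h1.const_mul (C * Real.exp (κ * |v|))) (ae_of_all _ fun u => by
      simp only [norm_mul, Real.norm_eq_abs, Real.abs_exp]
      calc _ ≤ Real.exp (θ * u) * (C * (Real.exp (κ * |v|) * Real.exp (κ * |u|))) := by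
            gcongr; exact hC _ _
        _ = _ := by ring)
  rw [integral_const_mul] at h2
  exact h2.trans_eq (by ring)

/-- Fubini's theorem for the double integral of the weighted increments. -/
theorem ExpGrowth.setIntegral_expIncr (hκ : 0 ≤ κ) (hκθ : κ < θ) (hρ : ExpGrowth κ ρ)
    (hST : S ⊆ Iic T) {s t : ℝ} (hst : s ≤ t) :
    IntegrableOn (fun u => Real.exp (θ * u) * expIncr θ ρ s t u) S ∧
    ∫ u in S, Real.exp (θ * u) * expIncr θ ρ s t u =
      Real.exp (θ * t) * expConv θ ρ S t - Real.exp (θ * s) * expConv θ ρ S s -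
        θ * ∫ v in s..t, Real.exp (θ * v) * expConv θ ρ S v := by
  have hi : ∀ t, IntegrableOn (fun u => Real.exp (θ * u) * ρ (t - u)) S := fun t =>
    ((hρ.comp_sub_left hκ t).integrableOn hκ hκθ T).mono_set hST
  have hp := hρ.integrable_prod hκ hκθ hST s t
  have hi3 : IntegrableOn (fun u => ∫ v in Ioc s t, Real.exp (θ * u) *
      (Real.exp (θ * v) * ρ (v - u))) S := hp.integral_prod_left
  have e : ∀ u, Real.exp (θ * u) * expIncr θ ρ s t u =
      Real.exp (θ * t) * (Real.exp (θ * u) * ρ (t - u)) -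
      Real.exp (θ * s) * (Real.exp (θ * u) * ρ (s - u)) -
      θ * ∫ v in Ioc s t, Real.exp (θ * u) * (Real.exp (θ * v) * ρ (v - u)) := by
    intro u
    rw [expIncr, intervalIntegral.integral_of_le hst, integral_const_mul]
    ring
  simp_rw [e]
  have i1 := (hi t).const_mul (Real.exp (θ * t))
  have i2 := (hi s).const_mul (Real.exp (θ * s))
  have i12 : Integrable (fun u => Real.exp (θ * t) * (Real.exp (θ * u) * ρ (t - u)) -
      Real.exp (θ * s) * (Real.exp (θ * u) * ρ (s - u))) (volume.restrict S) := i1.sub i2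
  refine ⟨i12.sub (hi3.const_mul θ), ?_⟩
  rw [integral_sub i12 (hi3.const_mul θ), integral_sub i1 i2, integral_const_mul,
    integral_const_mul, integral_const_mul, integral_integral_swap hp,
    intervalIntegral.integral_of_le hst]
  simp only [expConv]
  congr 2
  refine integral_congr_ae (ae_of_all _ fun v => ?_)
  simp only [← integral_const_mul]
  congr 1
  funext u
  ring

theorem expConv_Ioc_eq (hρ : Continuous ρ) {s : ℝ} (hs : 0 ≤ s) (v : ℝ) :
    expConv θ ρ (Ioc 0 s) v = Real.exp (θ * v) *
      ((∫ w in (0 : ℝ)..s - v, Real.exp (θ * w) * ρ (-w)) -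
        ∫ w in (0 : ℝ)..-v, Real.exp (θ * w) * ρ (-w)) := by
  have hc : Continuous fun w => Real.exp (θ * w) * ρ (-w) := by fun_prop
  rw [intervalIntegral.integral_interval_sub_left (hc.intervalIntegrable _ _)
    (hc.intervalIntegrable _ _), expConv, ← intervalIntegral.integral_of_le hs,
    ← intervalIntegral.integral_const_mul]
  have := intervalIntegral.integral_comp_sub_right
    (fun w => Real.exp (θ * v) * (Real.exp (θ * w) * ρ (-w))) v (a := 0) (b := s)
  rw [zero_sub] at this
  rw [← this]
  congr 1
  funext u
  rw [← mul_assoc, ← Real.exp_add]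
  ring_nf

/-- The substitution `w = u - v` moves `v` out of `ρ` into a limit of integration. The convolution
can then be differentiated although `ρ` is only continuous. -/
theorem ExpGrowth.expConv_Iic_eq (hκ : 0 ≤ κ) (hκθ : κ < θ) (hρ : ExpGrowth κ ρ) (v : ℝ) :
    expConv θ ρ (Iic 0) v = Real.exp (θ * v) *
      (expConv θ ρ (Iic 0) 0 + ∫ w in (0 : ℝ)..-v, Real.exp (θ * w) * ρ (-w)) := by
  have hint := fun v T => (hρ.comp_sub_left hκ v).integrableOn hκ hκθ T
  have h0 := fun T => hint 0 T
  simp only [zero_sub] at h0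
  have hE : expConv θ ρ (Iic 0) 0 = ∫ w in Iic 0, Real.exp (θ * w) * ρ (-w) := by
    simp [expConv]
  rw [hE, ← intervalIntegral.integral_Iic_sub_Iic (h0 0) (h0 (-v)), add_sub_cancel]
  have l1 := intervalIntegral_tendsto_integral_Iic 0 (hint v 0) tendsto_id
  have l2 := (intervalIntegral_tendsto_integral_Iic (-v) (h0 (-v))
    (tendsto_atBot_add_const_right atBot (-v) tendsto_id)).const_mul (Real.exp (θ * v))
  refine tendsto_nhds_unique l1 (l2.congr fun a => ?_)
  rw [← intervalIntegral.integral_const_mul]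
  have := intervalIntegral.integral_comp_sub_right
    (fun w => Real.exp (θ * v) * (Real.exp (θ * w) * ρ (-w))) v (a := a) (b := 0)
  rw [zero_sub] at this
  simp only [id, ← sub_eq_add_neg]
  rw [← this]
  congr 1
  funext u
  rw [← mul_assoc, ← Real.exp_add]
  ring_nf

theorem hasDerivAt_integral_exp_mul_comp_sub (hρ : Continuous ρ) (s v : ℝ) :
    HasDerivAt (fun v => ∫ w in (0 : ℝ)..s - v, Real.exp (θ * w) * ρ (-w))
      (-(Real.exp (θ * (s - v)) * ρ (v - s))) v := by
  have hc : Continuous fun w => Real.exp (θ * w) * ρ (-w) := by fun_prop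
  have h1 : HasDerivAt (fun y => ∫ w in (0 : ℝ)..y, Real.exp (θ * w) * ρ (-w))
      (Real.exp (θ * (s - v)) * ρ (-(s - v))) (s - v) :=
    intervalIntegral.integral_hasDerivAt_right (hc.intervalIntegrable _ _)
      (hc.stronglyMeasurableAtFilter _ _) hc.continuousAt
  have h2 : HasDerivAt (fun v : ℝ => s - v) (-1) v := by
    simpa using (hasDerivAt_id v).const_sub s
  have := h1.comp v h2
  simpa [Function.comp_def] using this

theorem hasDerivAt_exp_mul_const (θ v : ℝ) :
    HasDerivAt (fun v => Real.exp (θ * v)) (θ * Real.exp (θ * v)) v := by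
  have h1 : HasDerivAt (fun s : ℝ => θ * s) θ v := by
    simpa using (hasDerivAt_id v).const_mul θ
  exact h1.exp.congr_deriv (by ring)

theorem hasDerivAt_exp_mul_expConv_Ioc (hρ : Continuous ρ) {s : ℝ} (hs : 0 ≤ s) (v : ℝ) :
    HasDerivAt (fun v => Real.exp (θ * v) * expConv θ ρ (Ioc 0 s) v)
      (2 * θ * (Real.exp (θ * v) * expConv θ ρ (Ioc 0 s) v) +
        Real.exp (θ * v) * (ρ v - Real.exp (θ * s) * ρ (v - s))) v := by
  have e := expConv_Ioc_eq (θ := θ) hρ hs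
  have h0 := hasDerivAt_integral_exp_mul_comp_sub (θ := θ) hρ 0 v
  simp only [zero_sub, sub_zero] at h0
  have h := (hasDerivAt_exp_mul_const θ v).mul ((hasDerivAt_exp_mul_const θ v).mul
    ((hasDerivAt_integral_exp_mul_comp_sub (θ := θ) hρ s v).sub h0))
  simp_rw [e]
  refine h.congr_deriv ?_
  have e1 : Real.exp (θ * v) * Real.exp (θ * (s - v)) = Real.exp (θ * s) := by
    rw [← Real.exp_add]; ring_nf
  have e2 : Real.exp (θ * v) * Real.exp (θ * -v) = 1 := by
    rw [← Real.exp_add]; simp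
  simp only [Pi.mul_apply, Pi.sub_apply]
  rw [← e1]
  linear_combination Real.exp (θ * v) * ρ v * e2

theorem ExpGrowth.hasDerivAt_exp_mul_expConv_Iic (hκ : 0 ≤ κ) (hκθ : κ < θ)
    (hρ : ExpGrowth κ ρ) (v : ℝ) :
    HasDerivAt (fun v => Real.exp (θ * v) * expConv θ ρ (Iic 0) v)
      (2 * θ * (Real.exp (θ * v) * expConv θ ρ (Iic 0) v) + Real.exp (θ * v) * -ρ v) v := by
  have e := hρ.expConv_Iic_eq hκ hκθ
  have h0 := hasDerivAt_integral_exp_mul_comp_sub (θ := θ) hρ.1 0 v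
  simp only [zero_sub, sub_zero] at h0
  have h := (hasDerivAt_exp_mul_const θ v).mul ((hasDerivAt_exp_mul_const θ v).mul
    (h0.const_add (expConv θ ρ (Iic 0) 0)))
  have ef : (fun v => Real.exp (θ * v) * expConv θ ρ (Iic 0) v) = fun v => Real.exp (θ * v) *
      (Real.exp (θ * v) * (expConv θ ρ (Iic 0) 0 +
        ∫ w in (0 : ℝ)..-v, Real.exp (θ * w) * ρ (-w))) := funext fun v => by rw [← e]
  rw [ef, e v]
  refine h.congr_deriv ?_
  have e2 : Real.exp (θ * v) * Real.exp (θ * -v) = 1 := by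
    rw [← Real.exp_add]; simp
  simp only [Pi.mul_apply]
  linear_combination -Real.exp (θ * v) * ρ v * e2

theorem continuous_expConv_of_hasDerivAt {d : ℝ → ℝ}
    (h : ∀ v, HasDerivAt (fun v => Real.exp (θ * v) * expConv θ ρ S v) (d v) v) :
    Continuous (expConv θ ρ S) := by
  have h1 : Continuous fun v => Real.exp (θ * v) * expConv θ ρ S v :=
    continuous_iff_continuousAt.2 fun v => (h v).continuousAt
  have h2 : Continuous fun v => Real.exp (-(θ * v)) * (Real.exp (θ * v) * expConv θ ρ S v) := by
    fun_prop
  refine h2.congr fun v => ?_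
  rw [← mul_assoc, ← Real.exp_add]
  simp

/-- The weighted integral of the increments, once the convolution satisfies its differential
equation. -/
theorem ExpGrowth.setIntegral_expIncr_of_hasDerivAt (hκ : 0 ≤ κ) (hκθ : κ < θ)
    (hρ : ExpGrowth κ ρ) (hST : S ⊆ Iic T) {s t : ℝ} (hst : s ≤ t) {β : ℝ → ℝ}
    (hβ : Continuous β)
    (hd : ∀ v, HasDerivAt (fun v => Real.exp (θ * v) * expConv θ ρ S v)
      (2 * θ * (Real.exp (θ * v) * expConv θ ρ S v) + Real.exp (θ * v) * β v) v) :
    ∫ u in S, Real.exp (θ * u) * expIncr θ ρ s t u =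
      θ * (∫ v in s..t, Real.exp (θ * v) * expConv θ ρ S v) +
        ∫ v in s..t, Real.exp (θ * v) * β v := by
  have hc := continuous_expConv_of_hasDerivAt hd
  have i1 : Continuous fun v => 2 * θ * (Real.exp (θ * v) * expConv θ ρ S v) := by fun_prop
  have i2 : Continuous fun v => Real.exp (θ * v) * β v := by fun_prop
  have h := intervalIntegral.integral_eq_sub_of_hasDerivAt (a := s) (b := t) (fun v _ => hd v)
    ((i1.add i2).intervalIntegrable _ _)
  rw [intervalIntegral.integral_add (i1.intervalIntegrable _ _) (i2.intervalIntegrable _ _),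
    intervalIntegral.integral_const_mul] at h
  rw [(hρ.setIntegral_expIncr hκ hκθ hST hst).2, ← h]
  ring

/-- Integrating the differential equation of `e^{θ v} Ψ v` over `(-∞, 0]` gives `Ψ 0 = 2 θ ∫ e^{θ v}
Ψ - ∫ e^{θ v} ρ`, and evenness gives `Ψ 0 = ∫ e^{θ v} ρ`. -/
theorem ExpGrowth.setIntegral_exp_mul_expConv_Iic (hκ : 0 ≤ κ) (hκθ : κ < θ)
    (hρ : ExpGrowth κ ρ) (heven : ∀ u, ρ (-u) = ρ u) :
    IntegrableOn (fun u => Real.exp (θ * u) * expConv θ ρ (Iic 0) u) (Iic 0) ∧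
    θ * ∫ u in Iic 0, Real.exp (θ * u) * expConv θ ρ (Iic 0) u =
      ∫ u in Iic 0, Real.exp (θ * u) * ρ u := by
  have hd := hρ.hasDerivAt_exp_mul_expConv_Iic hκ hκθ
  have hg : ExpGrowth κ (expConv θ ρ (Iic 0)) :=
    ⟨continuous_expConv_of_hasDerivAt hd, hρ.expConv_bound hκ hκθ subset_rfl⟩
  have i1 := hg.integrableOn hκ hκθ 0
  have i2 := hρ.integrableOn hκ hκθ 0
  have i3 : IntegrableOn (fun u => Real.exp (θ * u) * -ρ u) (Iic 0) := by
    simp only [mul_neg]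
    exact i2.neg
  refine ⟨i1, ?_⟩
  have h := integral_Iic_of_hasDerivAt_of_tendsto' (fun v _ => hd v)
    ((i1.const_mul (2 * θ)).add i3) (hg.tendsto_exp_mul hκθ)
  rw [integral_add (i1.const_mul (2 * θ)) i3, integral_const_mul] at h
  simp only [mul_neg, integral_neg, mul_zero, Real.exp_zero, one_mul, sub_zero] at h
  have h0 : expConv θ ρ (Iic 0) 0 = ∫ u in Iic 0, Real.exp (θ * u) * ρ u := by
    simp [expConv, heven]
  rw [h0] at h
  linarith

end Deterministic

/-! ### Second moments -/

/-- A square integrable process with stationary increments and continuous paths started at `0`,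
whose paths and variance function grow at most quadratically. -/
structure IsRegularProcess {Ω : Type*} [MeasurableSpace Ω] (H : ℝ → Ω → ℝ) (P : Measure Ω) :
    Prop where
  measurable : ∀ t, Measurable (H t)
  continuous : ∀ ω, Continuous fun t => H t ω
  zero : ∀ ω, H 0 ω = 0
  growth : ∀ ω, ∃ C, ∀ u, |H u ω| ≤ C * (1 + |u|) ^ 2
  memLp : ∀ t, MemLp (H t) 2 P
  stationary : HasStationaryIncrements H P
  continuous_rho : Continuous (rhoG H P)
  growth_rho : ∃ C, ∀ u, |rhoG H P u| ≤ C * (1 + |u|) ^ 2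

namespace IsRegularProcess

variable {Ω : Type*} [MeasurableSpace Ω] {P : Measure Ω} {H : ℝ → Ω → ℝ} {κ θ T : ℝ} {S : Set ℝ}

theorem expGrowth (hH : IsRegularProcess H P) (hκ : 0 < κ) (ω : Ω) :
    ExpGrowth κ fun t => H t ω := by
  obtain ⟨C, hC⟩ := hH.growth ω
  exact ExpGrowth.of_le_sq hκ (hH.continuous ω) hC

theorem expGrowth_rho (hH : IsRegularProcess H P) (hκ : 0 < κ) : ExpGrowth κ (rhoG H P) := by
  obtain ⟨C, hC⟩ := hH.growth_rho
  exact ExpGrowth.of_le_sq hκ hH.continuous_rho hC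

theorem rho_zero (hH : IsRegularProcess H P) : rhoG H P 0 = 0 := by simp [rhoG, hH.zero]

theorem integral_sub_sq (hH : IsRegularProcess H P) (u v : ℝ) :
    ∫ ω, (H v ω - H u ω) ^ 2 ∂P = rhoG H P (v - u) := by
  -- Only a one-point marginal is needed: the increment over `[0, v - u]` shifted by `u`.
  have h := hH.stationary.identDistrib u (fun _ : Unit => v - u)
  have h1 := (h.comp (measurable_pi_apply ())).sq.integral_eq
  simp only [Function.comp_def, sub_add_cancel, hH.zero, sub_zero] at h1
  exact h1.symm

theorem rho_neg (hH : IsRegularProcess H P) (u : ℝ) : rhoG H P (-u) = rhoG H P u := by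
  have h := hH.integral_sub_sq u 0
  rw [zero_sub] at h
  rw [← h, rhoG]
  simp [hH.zero]

theorem integral_mul (hH : IsRegularProcess H P) (u v : ℝ) :
    ∫ ω, H u ω * H v ω ∂P = (rhoG H P u + rhoG H P v - rhoG H P (v - u)) / 2 := by
  have iu := (hH.memLp u).integrable_sq
  have iv := (hH.memLp v).integrable_sq
  have id := ((hH.memLp v).sub (hH.memLp u)).integrable_sq
  simp only [Pi.sub_apply] at id
  have iuv : Integrable (fun ω => (H u ω) ^ 2 + (H v ω) ^ 2) P := iu.add iv
  rw [← hH.integral_sub_sq, rhoG, rhoG, ← integral_add iu iv, ← integral_sub iuv id,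
    ← integral_div]
  congr 1
  funext ω
  ring

theorem measurable_uncurry (hH : IsRegularProcess H P) :
    Measurable fun p : ℝ × Ω => H p.1 p.2 :=
  measurable_uncurry_of_continuous_of_measurable hH.continuous hH.measurable

/-- Cauchy–Schwarz for the weight `e^{θ u}`, through the discriminant of `c ↦ ∫ e^{θ u} (H u - c) ^
2`. -/
theorem sq_setIntegral_le (hH : IsRegularProcess H P) (hθ : 0 < θ) (hST : S ⊆ Iic T) (ω : Ω) :
    (∫ u in S, Real.exp (θ * u) * H u ω) ^ 2 ≤
      (∫ u in S, Real.exp (θ * u)) * ∫ u in S, Real.exp (θ * u) * (H u ω) ^ 2 := by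
  -- The square of a path then has growth rate `θ / 2`, still below `θ`.
  have h4 : 0 < θ / 4 := by linarith
  have g := hH.expGrowth h4 ω
  have i0 : IntegrableOn (fun u : ℝ => Real.exp (θ * u)) S :=
    (integrableOn_exp_mul_Iic hθ T).mono_set hST
  have i1 : IntegrableOn (fun u : ℝ => Real.exp (θ * u) * H u ω) S :=
    (g.integrableOn h4.le (by linarith) T).mono_set hST
  have i2 : IntegrableOn (fun u : ℝ => Real.exp (θ * u) * (H u ω) ^ 2) S := by
    simp_rw [sq]
    exact ((g.mul g).integrableOn (by linarith) (by linarith) T).mono_set hST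
  have key : ∀ c : ℝ, 0 ≤ (∫ u in S, Real.exp (θ * u)) * (c * c) +
      (-2 * ∫ u in S, Real.exp (θ * u) * H u ω) * c +
      ∫ u in S, Real.exp (θ * u) * (H u ω) ^ 2 := by
    intro c
    have h0 : 0 ≤ ∫ u in S, Real.exp (θ * u) * (H u ω - c) ^ 2 :=
      integral_nonneg fun u => by positivity
    have j1 := i1.const_mul (-2 * c)
    have j0 := i0.const_mul (c * c)
    have j01 : Integrable (fun u => c * c * Real.exp (θ * u) +
      -2 * c * (Real.exp (θ * u) * H u ω)) (volume.restrict S) := j0.add j1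
    have e : ∀ u, Real.exp (θ * u) * (H u ω - c) ^ 2 = c * c * Real.exp (θ * u) +
      -2 * c * (Real.exp (θ * u) * H u ω) + Real.exp (θ * u) * (H u ω) ^ 2 := fun u => by ring
    simp_rw [e] at h0
    rw [integral_add j01 i2, integral_add j0 j1, integral_const_mul, integral_const_mul] at h0
    linarith
  have := discrim_le_zero key
  rw [discrim] at this
  linarith

theorem ouXi_sub (hH : IsRegularProcess H P) {s t : ℝ} (hst : s ≤ t) (ω : Ω) :
    ouXi θ (fun r => H r ω) t - ouXi θ (fun r => H r ω) s =
      Real.exp (θ * t) * H t ω - Real.exp (θ * s) * H s ω -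
        θ * ∫ u in Ioc s t, Real.exp (θ * u) * H u ω := by
  have hc : Continuous fun u => Real.exp (θ * u) * H u ω := by
    have := hH.continuous ω
    fun_prop
  rw [ouXi, ouXi, ← intervalIntegral.integral_of_le hst,
    ← intervalIntegral.integral_interval_sub_left (hc.intervalIntegrable 0 t)
      (hc.intervalIntegrable 0 s)]
  ring

variable [IsProbabilityMeasure P]

theorem integrable_prod_sq (hH : IsRegularProcess H P) (hθ : 0 < θ) (hST : S ⊆ Iic T) :
    Integrable (fun p : ℝ × Ω => Real.exp (θ * p.1) * (H p.1 p.2) ^ 2)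
      ((volume.restrict S).prod P) := by
  have hm := hH.measurable_uncurry
  rw [integrable_prod_iff (by fun_prop)]
  refine ⟨ae_of_all _ fun u => (hH.memLp u).integrable_sq.const_mul (Real.exp (θ * u)), ?_⟩
  have h := ((hH.expGrowth_rho (half_pos hθ)).integrableOn (half_pos hθ).le
    (half_lt_self hθ) T).mono_set hST
  refine h.congr (ae_of_all _ fun u => ?_)
  simp only [norm_mul, Real.norm_eq_abs, Real.abs_exp, abs_pow, sq_abs]
  rw [integral_const_mul, rhoG]

theorem integrable_prod_mul (hH : IsRegularProcess H P) (hθ : 0 < θ) (hST : S ⊆ Iic T)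
    {Y : Ω → ℝ} (hY : MemLp Y 2 P) :
    Integrable (fun p : ℝ × Ω => Y p.2 * (Real.exp (θ * p.1) * H p.1 p.2))
      ((volume.restrict S).prod P) := by
  have hm := hH.measurable_uncurry
  have hE : IntegrableOn (fun u : ℝ => Real.exp (θ * u)) S :=
    (integrableOn_exp_mul_Iic hθ T).mono_set hST
  have hYm : AEStronglyMeasurable (fun p : ℝ × Ω => Y p.2) ((volume.restrict S).prod P) :=
    hY.aestronglyMeasurable.comp_snd
  refine ((hH.integrable_prod_sq hθ hST).add (Integrable.mul_prod hE hY.integrable_sq)).mono'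
    (hYm.mul (by fun_prop)) (ae_of_all _ fun p => ?_)
  simp only [norm_mul, Real.norm_eq_abs, Real.abs_exp, Pi.add_apply]
  have h1 : |Y p.2| * |H p.1 p.2| ≤ (H p.1 p.2) ^ 2 + (Y p.2) ^ 2 := by
    rw [← sq_abs (H p.1 p.2), ← sq_abs (Y p.2)]
    nlinarith [sq_nonneg (|H p.1 p.2| - |Y p.2|), sq_nonneg |H p.1 p.2|, sq_nonneg |Y p.2|]
  calc |Y p.2| * (Real.exp (θ * p.1) * |H p.1 p.2|)
      = Real.exp (θ * p.1) * (|Y p.2| * |H p.1 p.2|) := by ring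
    _ ≤ Real.exp (θ * p.1) * ((H p.1 p.2) ^ 2 + (Y p.2) ^ 2) := by gcongr
    _ = _ := by ring

/-- The covariance of a square integrable variable with an exponentially weighted integral. -/
theorem integral_mul_setIntegral (hH : IsRegularProcess H P) (hθ : 0 < θ) (hST : S ⊆ Iic T)
    {Y : Ω → ℝ} (hY : MemLp Y 2 P) :
    ∫ ω, Y ω * (∫ u in S, Real.exp (θ * u) * H u ω) ∂P =
      ∫ u in S, Real.exp (θ * u) * ∫ ω, H u ω * Y ω ∂P := by
  have h := integral_integral_swap (f := fun u ω => Y ω * (Real.exp (θ * u) * H u ω))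
    (hH.integrable_prod_mul hθ hST hY)
  simp_rw [integral_const_mul] at h
  rw [← h]
  congr 1
  funext u
  rw [← integral_const_mul]
  congr 1
  funext ω
  ring

theorem memLp_setIntegral (hH : IsRegularProcess H P) (hθ : 0 < θ) (hST : S ⊆ Iic T) :
    MemLp (fun ω => ∫ u in S, Real.exp (θ * u) * H u ω) 2 P := by
  have hm := hH.measurable_uncurry
  have hmeas : AEStronglyMeasurable (fun ω => ∫ u in S, Real.exp (θ * u) * H u ω) P := by
    have : StronglyMeasurable (Function.uncurry fun (ω : Ω) (u : ℝ) =>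
        Real.exp (θ * u) * H u ω) := by
      refine Measurable.stronglyMeasurable ?_
      have := hm.comp measurable_swap
      exact (Measurable.mul (by fun_prop) this)
    exact this.integral_prod_right.aestronglyMeasurable
  rw [memLp_two_iff_integrable_sq hmeas]
  refine ((hH.integrable_prod_sq hθ hST).integral_prod_right.const_mul
    (∫ u in S, Real.exp (θ * u))).mono' (hmeas.pow 2) (ae_of_all _ fun ω => ?_)
  rw [Real.norm_eq_abs, abs_of_nonneg (sq_nonneg _)]
  exact hH.sq_setIntegral_le hθ hST ω

theorem memLp_ouPast (hH : IsRegularProcess H P) (hθ : 0 < θ) :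
    MemLp (fun ω => ouPast θ fun s => H s ω) 2 P :=
  (hH.memLp_setIntegral hθ subset_rfl).const_mul (-θ)

theorem memLp_ouXi (hH : IsRegularProcess H P) (hθ : 0 < θ) {t : ℝ} (ht : 0 ≤ t) :
    MemLp (fun ω => ouXi θ (fun s => H s ω) t) 2 P := by
  simp only [ouXi, intervalIntegral.integral_of_le ht]
  exact ((hH.memLp t).const_mul _).sub
    ((hH.memLp_setIntegral hθ (T := t) fun u hu => hu.2).const_mul θ)

theorem integral_mul_ouXi_sub (hH : IsRegularProcess H P) (hθ : 0 < θ) {s t : ℝ} (hst : s ≤ t)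
    (u : ℝ) :
    ∫ ω, H u ω * (ouXi θ (fun r => H r ω) t - ouXi θ (fun r => H r ω) s) ∂P =
      (expIncr θ (rhoG H P) s t 0 - expIncr θ (rhoG H P) s t u) / 2 := by
  have hL := hH.memLp_setIntegral hθ (S := Ioc s t) (T := t) fun u hu => hu.2
  have i1 : Integrable (fun ω => Real.exp (θ * t) * (H u ω * H t ω)) P :=
    ((hH.memLp u).integrable_mul (hH.memLp t)).const_mul _
  have i2 : Integrable (fun ω => Real.exp (θ * s) * (H u ω * H s ω)) P :=
    ((hH.memLp u).integrable_mul (hH.memLp s)).const_mul _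
  have i3 : Integrable (fun ω => θ * (H u ω * ∫ v in Ioc s t, Real.exp (θ * v) * H v ω)) P :=
    ((hH.memLp u).integrable_mul hL).const_mul _
  have e : ∀ ω, H u ω * (ouXi θ (fun r => H r ω) t - ouXi θ (fun r => H r ω) s) =
      Real.exp (θ * t) * (H u ω * H t ω) - Real.exp (θ * s) * (H u ω * H s ω) -
        θ * (H u ω * ∫ v in Ioc s t, Real.exp (θ * v) * H v ω) := by
    intro ω; rw [hH.ouXi_sub hst]; ring
  have i12 : Integrable (fun ω => Real.exp (θ * t) * (H u ω * H t ω) -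
    Real.exp (θ * s) * (H u ω * H s ω)) P := i1.sub i2
  simp_rw [e]
  rw [integral_sub i12 i3, integral_sub i1 i2, integral_const_mul, integral_const_mul,
    integral_const_mul, hH.integral_mul_setIntegral hθ (T := t) (fun u hu => hu.2) (hH.memLp u),
    hH.integral_mul, hH.integral_mul, ← intervalIntegral.integral_of_le hst]
  have hr := hH.continuous_rho
  have c1 : Continuous fun v => Real.exp (θ * v) * rhoG H P v := by fun_prop
  have c2 : Continuous fun v => Real.exp (θ * v) * rhoG H P (v - u) := by fun_prop
  have c3 : Continuous fun v => rhoG H P u * Real.exp (θ * v) := by fun_prop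
  have e2 : ∀ v, Real.exp (θ * v) * ∫ ω, H v ω * H u ω ∂P =
      (Real.exp (θ * v) * rhoG H P v + rhoG H P u * Real.exp (θ * v) -
        Real.exp (θ * v) * rhoG H P (v - u)) / 2 := by
    intro v
    simp_rw [mul_comm (H v _)]
    rw [hH.integral_mul]
    ring
  -- Constants have zero weighted increment, so the terms in `ρ u` coming from polarization cancel.
  have e3 : θ * ∫ v in s..t, Real.exp (θ * v) = Real.exp (θ * t) - Real.exp (θ * s) := by
    rw [← intervalIntegral.integral_const_mul]
    exact intervalIntegral.integral_eq_sub_of_hasDerivAt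
      (fun v _ => hasDerivAt_exp_mul_const θ v)
      (Continuous.intervalIntegrable (by fun_prop) _ _)
  have c13 : Continuous fun v => Real.exp (θ * v) * rhoG H P v + rhoG H P u * Real.exp (θ * v) :=
    c1.add c3
  simp_rw [e2]
  rw [intervalIntegral.integral_div, intervalIntegral.integral_sub (c13.intervalIntegrable _ _)
    (c2.intervalIntegrable _ _), intervalIntegral.integral_add (c1.intervalIntegrable _ _)
    (c3.intervalIntegrable _ _), intervalIntegral.integral_const_mul]
  simp only [expIncr, sub_zero]
  linear_combination (-(rhoG H P u) / 2) * e3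

/-- The term `∫ e^{θ v} ρ v` appears once from the increment at `u = 0` and once from the
differential equation of the convolution, with opposite signs. What survives is differentiable in `t
> 0` as soon as `ρ` is. -/
theorem integral_ouPast_mul_ouXi (hH : IsRegularProcess H P) (hθ : 0 < θ) {t : ℝ} (ht : 0 ≤ t) :
    ∫ ω, ouPast θ (fun s => H s ω) * ouXi θ (fun s => H s ω) t ∂P =
      (-(Real.exp (θ * t) * rhoG H P t) + θ ^ 2 *
        ∫ v in (0 : ℝ)..t, Real.exp (θ * v) * expConv θ (rhoG H P) (Iic 0) v) / 2 := by
  have hκ := (half_pos hθ).le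
  have hκθ := half_lt_self hθ
  have hρ := hH.expGrowth_rho (half_pos hθ)
  have hX0 : ∀ ω, ouXi θ (fun s => H s ω) 0 = 0 := fun ω => by simp [ouXi, hH.zero]
  have hm := fun u => hH.integral_mul_ouXi_sub hθ ht u
  simp only [hX0, sub_zero] at hm
  have e : ∀ ω, ouPast θ (fun s => H s ω) * ouXi θ (fun s => H s ω) t =
      -θ * (ouXi θ (fun s => H s ω) t * ∫ u in Iic 0, Real.exp (θ * u) * H u ω) := fun ω => by
    rw [ouPast]; ring
  simp_rw [e]
  rw [integral_const_mul, hH.integral_mul_setIntegral hθ subset_rfl (hH.memLp_ouXi hθ ht)]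
  simp_rw [hm]
  have i0 : IntegrableOn (fun u : ℝ => expIncr θ (rhoG H P) 0 t 0 * Real.exp (θ * u)) (Iic 0) :=
    (integrableOn_exp_mul_Iic hθ 0).const_mul _
  have e1 : ∀ u, Real.exp (θ * u) *
      ((expIncr θ (rhoG H P) 0 t 0 - expIncr θ (rhoG H P) 0 t u) / 2) =
      (expIncr θ (rhoG H P) 0 t 0 * Real.exp (θ * u) -
        Real.exp (θ * u) * expIncr θ (rhoG H P) 0 t u) / 2 := fun u => by ring
  simp_rw [e1]
  rw [integral_div, integral_sub i0 (hρ.setIntegral_expIncr hκ hκθ subset_rfl ht).1,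
    integral_const_mul, integral_exp_mul_Iic hθ,
    hρ.setIntegral_expIncr_of_hasDerivAt hκ hκθ subset_rfl ht hH.continuous_rho.neg
      (hρ.hasDerivAt_exp_mul_expConv_Iic hκ hκθ)]
  simp only [expIncr, sub_zero, hH.rho_zero, mul_zero, Real.exp_zero, Pi.neg_apply, mul_neg,
    intervalIntegral.integral_neg]
  field_simp
  ring

theorem integral_ouXi_mul_ouXi_sub (hH : IsRegularProcess H P) (hθ : 0 < θ) {s t : ℝ}
    (hs : 0 ≤ s) (hst : s ≤ t) :
    ∫ ω, ouXi θ (fun r => H r ω) s *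
        (ouXi θ (fun r => H r ω) t - ouXi θ (fun r => H r ω) s) ∂P =
      (Real.exp (θ * t) * rhoG H P t - Real.exp (θ * s) * rhoG H P s -
        Real.exp (θ * s) * Real.exp (θ * t) * rhoG H P (t - s) + θ ^ 2 *
        ∫ v in s..t, Real.exp (θ * v) * expConv θ (rhoG H P) (Ioc 0 s) v) / 2 := by
  have hκ := (half_pos hθ).le
  have hκθ := half_lt_self hθ
  have hρ := hH.expGrowth_rho (half_pos hθ)
  have hr := hH.continuous_rho
  have hsub : Ioc 0 s ⊆ Iic s := fun u hu => hu.2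
  have hm := fun u => hH.integral_mul_ouXi_sub hθ hst u
  have hY : MemLp (fun ω => ouXi θ (fun r => H r ω) t - ouXi θ (fun r => H r ω) s) 2 P :=
    (hH.memLp_ouXi hθ (hs.trans hst)).sub (hH.memLp_ouXi hθ hs)
  have e : ∀ ω, ouXi θ (fun r => H r ω) s *
      (ouXi θ (fun r => H r ω) t - ouXi θ (fun r => H r ω) s) =
      Real.exp (θ * s) *
        (H s ω * (ouXi θ (fun r => H r ω) t - ouXi θ (fun r => H r ω) s)) -
      θ * ((ouXi θ (fun r => H r ω) t - ouXi θ (fun r => H r ω) s) *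
        ∫ u in Ioc 0 s, Real.exp (θ * u) * H u ω) := fun ω => by
    have h : ouXi θ (fun r => H r ω) s = Real.exp (θ * s) * H s ω -
        θ * ∫ u in Ioc 0 s, Real.exp (θ * u) * H u ω := by
      rw [ouXi, intervalIntegral.integral_of_le hs]
    linear_combination (ouXi θ (fun r => H r ω) t - ouXi θ (fun r => H r ω) s) * h
  have i1 : Integrable (fun ω => Real.exp (θ * s) *
      (H s ω * (ouXi θ (fun r => H r ω) t - ouXi θ (fun r => H r ω) s))) P :=
    ((hH.memLp s).integrable_mul hY).const_mul _
  have i2 : Integrable (fun ω => θ * ((ouXi θ (fun r => H r ω) t - ouXi θ (fun r => H r ω) s) *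
        ∫ u in Ioc 0 s, Real.exp (θ * u) * H u ω)) P :=
    (hY.integrable_mul (hH.memLp_setIntegral hθ hsub)).const_mul _
  simp_rw [e]
  rw [integral_sub i1 i2, integral_const_mul, integral_const_mul,
    hH.integral_mul_setIntegral hθ hsub hY]
  simp_rw [hm]
  have i0 : IntegrableOn (fun u : ℝ => expIncr θ (rhoG H P) s t 0 * Real.exp (θ * u))
      (Ioc 0 s) := ((integrableOn_exp_mul_Iic hθ s).mono_set hsub).const_mul _
  have e1 : ∀ u, Real.exp (θ * u) *
      ((expIncr θ (rhoG H P) s t 0 - expIncr θ (rhoG H P) s t u) / 2) =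
      (expIncr θ (rhoG H P) s t 0 * Real.exp (θ * u) -
        Real.exp (θ * u) * expIncr θ (rhoG H P) s t u) / 2 := fun u => by ring
  have e3 : θ * ∫ v in (0 : ℝ)..s, Real.exp (θ * v) = Real.exp (θ * s) - 1 := by
    rw [← intervalIntegral.integral_const_mul]
    simp
  rw [intervalIntegral.integral_of_le hs] at e3
  have hβ : Continuous fun v => rhoG H P v - Real.exp (θ * s) * rhoG H P (v - s) := by fun_prop
  have c1 : Continuous fun v => Real.exp (θ * v) * rhoG H P v := by fun_prop
  have c2 : Continuous fun v => Real.exp (θ * s) * (Real.exp (θ * v) * rhoG H P (v - s)) := by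
    fun_prop
  have e4 : ∫ v in s..t, Real.exp (θ * v) *
      (rhoG H P v - Real.exp (θ * s) * rhoG H P (v - s)) =
      (∫ v in s..t, Real.exp (θ * v) * rhoG H P v) -
        Real.exp (θ * s) * ∫ v in s..t, Real.exp (θ * v) * rhoG H P (v - s) := by
    rw [← intervalIntegral.integral_const_mul, ← intervalIntegral.integral_sub
      (c1.intervalIntegrable _ _) (c2.intervalIntegrable _ _)]
    congr 1
    funext v
    ring
  simp_rw [e1]
  rw [integral_div, integral_sub i0 (hρ.setIntegral_expIncr hκ hκθ hsub hst).1,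
    integral_const_mul, hρ.setIntegral_expIncr_of_hasDerivAt hκ hκθ hsub hst hβ
      (hasDerivAt_exp_mul_expConv_Ioc hr hs), e4]
  simp only [expIncr, sub_zero, sub_self, hH.rho_zero, mul_zero]
  linear_combination (-(Real.exp (θ * t) * rhoG H P t - Real.exp (θ * s) * rhoG H P s -
    θ * ∫ v in s..t, Real.exp (θ * v) * rhoG H P v) / 2) * e3

theorem integral_ouPast_sq (hH : IsRegularProcess H P) (hθ : 0 < θ) :
    ∫ ω, (ouPast θ fun s => H s ω) ^ 2 ∂P =
      θ / 2 * ∫ u in Iic 0, Real.exp (θ * u) * rhoG H P u := by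
  have hκ := (half_pos hθ).le
  have hκθ := half_lt_self hθ
  have hρ := hH.expGrowth_rho (half_pos hθ)
  have hL := hH.memLp_setIntegral hθ (S := Iic 0) subset_rfl
  set K := ∫ u in Iic 0, Real.exp (θ * u) * rhoG H P u with hK
  have e : ∀ ω, (ouPast θ fun s => H s ω) ^ 2 = θ ^ 2 *
      ((∫ u in Iic 0, Real.exp (θ * u) * H u ω) * ∫ u in Iic 0, Real.exp (θ * u) * H u ω) :=
    fun ω => by rw [ouPast]; ring
  simp_rw [e]
  rw [integral_const_mul, hH.integral_mul_setIntegral hθ subset_rfl hL]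
  have iE := integrableOn_exp_mul_Iic hθ 0
  have iρ := hρ.integrableOn hκ hκθ 0
  obtain ⟨iΨ, hΨ⟩ := hρ.setIntegral_exp_mul_expConv_Iic hκ hκθ hH.rho_neg
  have hinner : ∀ u, ∫ ω, H u ω * (∫ v in Iic 0, Real.exp (θ * v) * H v ω) ∂P =
      (rhoG H P u / θ + K - expConv θ (rhoG H P) (Iic 0) u) / 2 := by
    intro u
    rw [hH.integral_mul_setIntegral hθ subset_rfl (hH.memLp u)]
    have e2 : ∀ v, Real.exp (θ * v) * ∫ ω, H v ω * H u ω ∂P =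
        (rhoG H P u * Real.exp (θ * v) + Real.exp (θ * v) * rhoG H P v -
          Real.exp (θ * v) * rhoG H P (u - v)) / 2 := fun v => by
      rw [hH.integral_mul]; ring
    have j1 : IntegrableOn (fun v => rhoG H P u * Real.exp (θ * v)) (Iic 0) := iE.const_mul _
    have j2 : IntegrableOn (fun v => rhoG H P u * Real.exp (θ * v) +
      Real.exp (θ * v) * rhoG H P v) (Iic 0) := j1.add iρ
    simp_rw [e2]
    rw [integral_div, integral_sub j2 ((hρ.comp_sub_left hκ u).integrableOn hκ hκθ 0),
      integral_add j1 iρ, integral_const_mul, integral_exp_mul_Iic hθ, expConv]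
    simp [hK, div_eq_mul_inv]
  simp_rw [hinner]
  have e3 : ∀ u, Real.exp (θ * u) *
      ((rhoG H P u / θ + K - expConv θ (rhoG H P) (Iic 0) u) / 2) =
      (θ⁻¹ * (Real.exp (θ * u) * rhoG H P u) + K * Real.exp (θ * u) -
        Real.exp (θ * u) * expConv θ (rhoG H P) (Iic 0) u) / 2 := fun u => by ring
  have j1 : IntegrableOn (fun u => θ⁻¹ * (Real.exp (θ * u) * rhoG H P u)) (Iic 0) :=
    iρ.const_mul _
  have j2 : IntegrableOn (fun u => K * Real.exp (θ * u)) (Iic 0) := iE.const_mul _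
  have j3 : IntegrableOn (fun u => θ⁻¹ * (Real.exp (θ * u) * rhoG H P u) +
    K * Real.exp (θ * u)) (Iic 0) := j1.add j2
  simp_rw [e3]
  rw [integral_div, integral_sub j3 iΨ, integral_add j1 j2, integral_const_mul,
    integral_const_mul, integral_exp_mul_Iic hθ, ← hK]
  rw [← hK] at hΨ
  simp only [mul_zero, Real.exp_zero]
  have hθ0 := hθ.ne'
  have hΨ' : ∫ u in Iic 0, Real.exp (θ * u) * expConv θ (rhoG H P) (Iic 0) u = K / θ := by
    rw [eq_div_iff hθ0, mul_comm]; exact hΨ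
  rw [hΨ']
  field_simp
  ring

end IsRegularProcess

/-! ### Improper integrals -/

/-- Continuity of the primitive at `s` absorbs a possible singularity of `F` there. -/
theorem HasImproperIntegral.eq_sub_of_hasDerivAt {s t L : ℝ} {F E : ℝ → ℝ}
    (h : HasImproperIntegral (𝓝[>] s) t F L) (hst : s ≤ t) (hE : Continuous E)
    (hd : ∀ v ∈ Ioo s t, HasDerivAt E (F v) v) : L = E t - E s := by
  obtain ⟨hint, hL⟩ := h
  rcases hst.eq_or_lt with rfl | hst
  · rw [sub_self]
    -- When `s = t` the variable limit lies to the right of `t`, so the integrals run backwards;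
    -- integrability on one interval `[s, b]` forces them to `0`.
    obtain ⟨b, hb, hsb⟩ := (hint.and self_mem_nhdsWithin).exists
    have hsb : s < b := hsb
    have hc := intervalIntegral.continuousOn_primitive_interval' hb.symm left_mem_uIcc
    have hc0 : ContinuousWithinAt (fun x => ∫ u in s..x, F u) (uIcc s b) s := hc s left_mem_uIcc
    have h2 : Tendsto (fun x => ∫ u in s..x, F u) (𝓝[>] s) (𝓝 0) := by
      have h3 := hc0.tendsto
      rw [intervalIntegral.integral_same, uIcc_of_le hsb.le] at h3
      exact h3.mono_left (by
        rw [← nhdsWithin_Ioc_eq_nhdsGT hsb]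
        exact nhdsWithin_mono _ Ioc_subset_Icc_self)
    have h4 : Tendsto (fun x => ∫ u in x..s, F u) (𝓝[>] s) (𝓝 0) := by
      simpa only [neg_zero] using h2.neg.congr fun x => (intervalIntegral.integral_symm _ _).symm
    exact tendsto_nhds_unique hL h4
  · have h1 : Tendsto (fun a => E t - E a) (𝓝[>] s) (𝓝 (E t - E s)) :=
      ((hE.tendsto s).const_sub (E t)).mono_left nhdsWithin_le_nhds
    refine tendsto_nhds_unique hL (h1.congr' ?_)
    filter_upwards [hint, Ioo_mem_nhdsGT hst] with a ha has
    refine (intervalIntegral.integral_eq_sub_of_hasDerivAt_of_le has.2.le hE.continuousOn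
      (fun v hv => hd v ⟨has.1.trans hv.1, hv.2⟩) ha).symm

/-- By the mean value theorem on `[a - 1, a]`, the derivative takes values along a sequence of
points going to `-∞` that equal differences of `f`, which vanish in the limit. -/
theorem eq_zero_of_tendsto_deriv_atBot {f f' : ℝ → ℝ} {c m : ℝ}
    (hf : ∀ x < c, HasDerivAt f (f' x) x) (h : Tendsto f atBot (𝓝 0))
    (h' : Tendsto f' atBot (𝓝 m)) : m = 0 := by
  have hex : ∀ a, ∃ x, a < c → x ∈ Ioo (a - 1) a ∧ f' x = f a - f (a - 1) := by
    intro a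
    by_cases ha : a < c
    · obtain ⟨x, hx, hx'⟩ := exists_hasDerivAt_eq_slope f f' (by linarith : a - 1 < a)
        (fun y hy => (hf y (hy.2.trans_lt ha)).continuousAt.continuousWithinAt)
        (fun y hy => hf y (hy.2.trans ha))
      exact ⟨x, fun _ => ⟨hx, by simpa using hx'⟩⟩
    · exact ⟨a, fun h => absurd h ha⟩
  choose x hx using hex
  have hxt : Tendsto x atBot atBot := by
    refine tendsto_atBot_mono' _ ?_ tendsto_id
    filter_upwards [eventually_lt_atBot c] with a ha using (hx a ha).1.2.le
  have h1 : Tendsto (fun a => f a - f (a - 1)) atBot (𝓝 0) := by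
    have := h.sub (h.comp (tendsto_atBot_add_const_right atBot (-1) tendsto_id))
    simpa [Function.comp_def, sub_eq_add_neg] using this
  refine tendsto_nhds_unique (h'.comp hxt) (h1.congr' ?_)
  filter_upwards [eventually_lt_atBot c] with a ha using (hx a ha).2.symm

section SecondDerivative

variable {ρ : ℝ → ℝ} {θ : ℝ}

theorem ContDiffOn.two_compl_zero (h : ContDiffOn ℝ 2 ρ {0}ᶜ) :
    (∀ x ≠ 0, HasDerivAt ρ (deriv ρ x) x) ∧
    (∀ x ≠ 0, HasDerivAt (deriv ρ) (deriv (deriv ρ) x) x) ∧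
    ContinuousOn (deriv (deriv ρ)) {0}ᶜ := by
  have ho : IsOpen ({0}ᶜ : Set ℝ) := isOpen_compl_singleton
  have h1 := (contDiffOn_succ_iff_deriv_of_isOpen (n := 1) ho).1 h
  have h2 := (contDiffOn_succ_iff_deriv_of_isOpen (n := 0) ho).1 h1.2.2
  exact ⟨fun x hx => (h1.1.differentiableAt (ho.mem_nhds hx)).hasDerivAt,
    fun x hx => (h2.1.differentiableAt (ho.mem_nhds hx)).hasDerivAt, h2.2.2.continuousOn⟩

theorem integral_exp_mul_deriv_deriv (h : ContDiffOn ℝ 2 ρ {0}ᶜ) (hc : Continuous ρ)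
    {a b v : ℝ} (hab : a ≤ b) (hbv : b < v) :
    ∫ u in a..b, Real.exp (θ * u) * deriv (deriv ρ) (v - u) =
      Real.exp (θ * a) * (deriv ρ (v - a) + θ * ρ (v - a)) -
        Real.exp (θ * b) * (deriv ρ (v - b) + θ * ρ (v - b)) +
        θ ^ 2 * ∫ u in a..b, Real.exp (θ * u) * ρ (v - u) := by
  obtain ⟨h1, h2, h3⟩ := h.two_compl_zero
  have hne : ∀ u ∈ uIcc a b, v - u ≠ 0 := fun u hu => by
    rw [uIcc_of_le hab] at hu
    linarith [hu.2] |> fun (h : 0 < v - u) => h.ne'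
  have hd : ∀ u ∈ uIcc a b, HasDerivAt
      -- A primitive that does both integrations by parts at once; `b < v` keeps the argument of `ρ`
      -- away from `0`.
      (fun u => -(Real.exp (θ * u) * (deriv ρ (v - u) + θ * ρ (v - u))))
      (Real.exp (θ * u) * deriv (deriv ρ) (v - u) - θ ^ 2 * (Real.exp (θ * u) * ρ (v - u))) u := by
    intro u hu
    have hs : HasDerivAt (fun u : ℝ => v - u) (-1) u := by
      simpa using (hasDerivAt_id u).const_sub v
    have e1 := (h1 (v - u) (hne u hu)).comp u hs
    have e2 := (h2 (v - u) (hne u hu)).comp u hs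
    have := ((hasDerivAt_exp_mul_const θ u).mul (e2.add (e1.const_mul θ))).neg
    refine this.congr_deriv ?_
    simp only [Pi.add_apply, Function.comp_apply]
    ring
  have i1 : IntervalIntegrable (fun u => Real.exp (θ * u) * deriv (deriv ρ) (v - u))
      volume a b := by
    refine ContinuousOn.intervalIntegrable ?_
    refine ContinuousOn.mul (by fun_prop) (h3.comp (by fun_prop) fun u hu => hne u hu)
  have i2 : IntervalIntegrable (fun u => θ ^ 2 * (Real.exp (θ * u) * ρ (v - u))) volume a b :=
    Continuous.intervalIntegrable (by fun_prop) _ _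
  have := intervalIntegral.integral_eq_sub_of_hasDerivAt hd (i1.sub i2)
  rw [intervalIntegral.integral_sub i1 i2, intervalIntegral.integral_const_mul] at this
  linarith

/-- No growth of `ρ'` is assumed. Convergence of the improper integral itself forces `e^{θ a} ρ' (v
- a)` to have a limit as `a → -∞`, and this limit is `0` because `e^{θ a} ρ (v - a)` tends to `0`
while its derivative converges. -/
theorem HasImproperIntegral.eq_of_expGrowth {κ v J : ℝ} (h : ContDiffOn ℝ 2 ρ {0}ᶜ)
    (hκ : 0 ≤ κ) (hκθ : κ < θ) (hρ : ExpGrowth κ ρ) (hv : 0 < v)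
    (hJ : HasImproperIntegral atBot 0
      (fun u => Real.exp (θ * u) * Real.exp (θ * v) * deriv (deriv ρ) (v - u)) J) :
    J = Real.exp (θ * v) *
      (-(deriv ρ v + θ * ρ v) + θ ^ 2 * expConv θ ρ (Iic 0) v) := by
  obtain ⟨-, hJ⟩ := hJ
  have hg := hρ.comp_sub_left hκ v
  have hI := intervalIntegral_tendsto_integral_Iic 0 (hg.integrableOn hκ hκθ 0) tendsto_id
  have h0 := hg.tendsto_exp_mul hκθ
  have e : ∀ᶠ a in atBot, Real.exp (-(θ * v)) * (∫ u in a..0, Real.exp (θ * u) *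
      Real.exp (θ * v) * deriv (deriv ρ) (v - u)) + (deriv ρ v + θ * ρ v) -
      θ * (Real.exp (θ * a) * ρ (v - a)) -
      θ ^ 2 * (∫ u in id a..0, Real.exp (θ * u) * ρ (v - u)) =
      Real.exp (θ * a) * deriv ρ (v - a) := by
    filter_upwards [eventually_le_atBot 0] with a ha
    have := integral_exp_mul_deriv_deriv (θ := θ) h hρ.1 ha hv
    have e2 : ∫ u in a..0, Real.exp (θ * u) * Real.exp (θ * v) * deriv (deriv ρ) (v - u) =
        Real.exp (θ * v) * ∫ u in a..0, Real.exp (θ * u) * deriv (deriv ρ) (v - u) := by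
      rw [← intervalIntegral.integral_const_mul]
      congr 1
      funext u
      ring
    rw [e2, ← mul_assoc, ← Real.exp_add, neg_add_cancel, Real.exp_zero, one_mul, this]
    simp only [mul_zero, Real.exp_zero, sub_zero, one_mul, id]
    ring
  have hlim := ((((hJ.const_mul (Real.exp (-(θ * v)))).add_const (deriv ρ v + θ * ρ v)).sub
    (h0.const_mul θ)).sub (hI.const_mul (θ ^ 2))).congr' e
  have hder : ∀ a < 0, HasDerivAt (fun a => Real.exp (θ * a) * ρ (v - a))
      (θ * (Real.exp (θ * a) * ρ (v - a)) - Real.exp (θ * a) * deriv ρ (v - a)) a := by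
    intro a ha
    have hs : HasDerivAt (fun u : ℝ => v - u) (-1) a := by
      simpa using (hasDerivAt_id a).const_sub v
    have e1 := (h.two_compl_zero.1 (v - a) (by linarith [hv, ha] |> fun (h : 0 < v - a) =>
      h.ne')).comp a hs
    refine ((hasDerivAt_exp_mul_const θ a).mul e1).congr_deriv ?_
    simp only [Function.comp_apply]
    ring
  have hz := eq_zero_of_tendsto_deriv_atBot hder h0 ((h0.const_mul θ).sub hlim)
  have hee : Real.exp (θ * v) * Real.exp (-(θ * v)) = 1 := by rw [← Real.exp_add]; simp
  rw [expConv]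
  linear_combination (-J) * hee - Real.exp (θ * v) * hz

end SecondDerivative

/-! ### Ornstein-Uhlenbeck processes driven by regular processes -/

section Values

variable {Ω : Type*} {H : ℝ → Ω → ℝ} {κ θ : ℝ} {ω : Ω}

theorem ouZ_eq (hκ : 0 ≤ κ) (hκθ : κ < θ) (hg : ExpGrowth κ fun s => H s ω) (t : ℝ) :
    ouZ θ H t ω =
      Real.exp (-θ * t) * (ouPast θ (fun s => H s ω) + ouXi θ (fun s => H s ω) t) :=
  (hasRSIntegralIic_exp_shift hκ hκθ hg t).rsIntegralIic_eq

theorem ouX_eq (hc : Continuous fun s => H s ω) (h0 : H 0 ω = 0) {t : ℝ} (ht : 0 ≤ t) :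
    ouX θ H t ω = Real.exp (-θ * t) * ouXi θ (fun s => H s ω) t := by
  rw [ouX, (hasRSIntegral_exp_zero hc h0 ht).rsIntegral_eq]

end Values

/-! ### Regularity of the variance function under the moment assumption -/

section Variance

variable {Ω : Type*} [MeasurableSpace Ω] {P : Measure Ω} {G H : ℝ → Ω → ℝ}

theorem rhoG_congr (h : ∀ t, H t =ᵐ[P] G t) : rhoG H P = rhoG G P := by
  funext t
  exact integral_congr_ae ((h t).fun_comp fun x => x ^ 2)

theorem IncrementMomentAssumption.exists_second (hA : IncrementMomentAssumption G P)
    (h : ∀ t, H t =ᵐ[P] G t) :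
    ∃ γ c : ℝ, 0 < γ ∧ γ < 1 ∧ 0 ≤ c ∧ ∀ t,
      ∫⁻ ω, ENNReal.ofReal ((H t ω) ^ 2) ∂P ≤ ENNReal.ofReal (c * |t| ^ (2 * γ)) := by
  obtain ⟨h0, γ, hγ0, hγ1, hb⟩ := hA
  obtain ⟨c, hc, hb⟩ := hb 2 le_rfl
  refine ⟨γ, c, hγ0, hγ1, hc.le, fun t => ?_⟩
  have := hb 0 t
  rw [sub_zero] at this
  refine (lintegral_congr_ae ?_).trans_le this
  filter_upwards [h t, h0] with ω h1 h2
  rw [h1, h2, sub_zero, Real.rpow_two, sq_abs]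

theorem IncrementMomentAssumption.isRegularProcess (hA : IncrementMomentAssumption G P)
    (hm : ∀ t, Measurable (H t)) (hc : ∀ ω, Continuous fun t => H t ω) (h0 : ∀ ω, H 0 ω = 0)
    (hg : ∀ ω, ∃ C, ∀ u, |H u ω| ≤ C * (1 + |u|) ^ 2) (h : ∀ t, H t =ᵐ[P] G t)
    (hstat : HasStationaryIncrements G P) (hρ : ContinuousOn (rhoG G P) {0}ᶜ) :
    IsRegularProcess H P := by
  obtain ⟨γ, c, hγ0, hγ1, hc0, hb⟩ := hA.exists_second h
  have hint : ∀ t, Integrable (fun ω => (H t ω) ^ 2) P := fun t =>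
    ⟨((hm t).pow_const 2).aestronglyMeasurable,
      (hasFiniteIntegral_iff_ofReal (ae_of_all _ fun ω => sq_nonneg _)).2
        ((hb t).trans_lt ENNReal.ofReal_lt_top)⟩
  have hle : ∀ t, |rhoG H P t| ≤ c * |t| ^ (2 * γ) := by
    intro t
    have hn : 0 ≤ rhoG H P t := integral_nonneg fun ω => sq_nonneg _
    rw [abs_of_nonneg hn, ← ENNReal.ofReal_le_ofReal_iff (by positivity), rhoG,
      ofReal_integral_eq_lintegral_ofReal (hint t) (ae_of_all _ fun ω => sq_nonneg _)]
    exact hb t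
  refine ⟨hm, hc, h0, hg, fun t => ?_, hstat.congr h, ?_, c, fun t => (hle t).trans ?_⟩
  · exact (memLp_two_iff_integrable_sq (hm t).aestronglyMeasurable).2 (hint t)
  -- At `0`, where smoothness is not assumed, continuity comes from the moment bound `c |t| ^ (2
  -- γ)`.
  · rw [continuous_iff_continuousAt]
    intro t
    rcases eq_or_ne t 0 with rfl | ht
    · have hz : rhoG H P 0 = 0 := by simp [rhoG, h0]
      rw [ContinuousAt, hz]
      refine squeeze_zero_norm hle ?_
      have : ContinuousAt (fun t : ℝ => c * |t| ^ (2 * γ)) 0 :=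
        (continuous_abs.continuousAt.rpow_const (Or.inr (by positivity))).const_mul c
      have h2 := this.tendsto
      simpa [Real.zero_rpow (by positivity : 2 * γ ≠ 0)] using h2
    · rw [rhoG_congr h]
      exact hρ.continuousAt (isOpen_compl_singleton.mem_nhds ht)
  · gcongr
    calc |t| ^ (2 * γ) ≤ (1 + |t|) ^ (2 * γ) := by gcongr; linarith
      _ ≤ (1 + |t|) ^ (2 : ℝ) :=
        Real.rpow_le_rpow_of_exponent_le (by linarith [abs_nonneg t]) (by linarith)
      _ = _ := Real.rpow_two _

end Variance

/-! ### Second-order formulas for a regular driving process -/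

namespace IsRegularProcess

variable {Ω : Type*} [MeasurableSpace Ω] {P : Measure Ω}
  {H : ℝ → Ω → ℝ} {θ : ℝ}

theorem ouZ_eq (hH : IsRegularProcess H P) (hθ : 0 < θ) (t : ℝ) (ω : Ω) : ouZ θ H t ω =
    Real.exp (-θ * t) * (ouPast θ (fun s => H s ω) + ouXi θ (fun s => H s ω) t) :=
  _root_.ouZ_eq (half_pos hθ).le (half_lt_self hθ) (hH.expGrowth (half_pos hθ) ω) t

theorem ouX_eq (hH : IsRegularProcess H P) {t : ℝ} (ht : 0 ≤ t) (ω : Ω) :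
    ouX θ H t ω = Real.exp (-θ * t) * ouXi θ (fun s => H s ω) t :=
  _root_.ouX_eq (hH.continuous ω) (hH.zero ω) ht

theorem ouZ_zero (hH : IsRegularProcess H P) (hθ : 0 < θ) (ω : Ω) :
    ouZ θ H 0 ω = ouPast θ fun s => H s ω := by
  rw [hH.ouZ_eq hθ]
  simp [ouXi, hH.zero]

variable [IsProbabilityMeasure P]

theorem memLp_ouX (hH : IsRegularProcess H P) (hθ : 0 < θ) {t : ℝ} (ht : 0 ≤ t) :
    MemLp (ouX θ H t) 2 P := by
  rw [show ouX θ H t = _ from funext fun ω => hH.ouX_eq ht ω]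
  exact (hH.memLp_ouXi hθ ht).const_mul _

theorem memLp_ouZ (hH : IsRegularProcess H P) (hθ : 0 < θ) {t : ℝ} (ht : 0 ≤ t) :
    MemLp (ouZ θ H t) 2 P := by
  rw [show ouZ θ H t = _ from funext fun ω => hH.ouZ_eq hθ t ω]
  exact ((hH.memLp_ouPast hθ).add (hH.memLp_ouXi hθ ht)).const_mul _

theorem integral_ouZ_mul_ouZ_zero (hH : IsRegularProcess H P) (hθ : 0 < θ)
    (hρ : ContDiffOn ℝ 2 (rhoG H P) {0}ᶜ) {t : ℝ} (ht : 0 ≤ t) {J : ℝ → ℝ} {L : ℝ}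
    (hJ : ∀ v ∈ Ioo 0 t, HasImproperIntegral atBot 0
      (fun u => Real.exp (θ * u) * Real.exp (θ * v) * deriv (deriv (rhoG H P)) (v - u)) (J v))
    (hL : HasImproperIntegral (𝓝[>] 0) t J L) :
    ∫ ω, ouZ θ H t ω * ouZ θ H 0 ω ∂P =
      Real.exp (-θ * t) * ∫ ω, (ouZ θ H 0 ω) ^ 2 ∂P + Real.exp (-θ * t) / 2 * L := by
  have hκ := (half_pos hθ).le
  have hκθ := half_lt_self hθ
  have hg := hH.expGrowth_rho (half_pos hθ)
  have hΨ := continuous_expConv_of_hasDerivAt (hg.hasDerivAt_exp_mul_expConv_Iic hκ hκθ)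
  have hc : Continuous fun v => Real.exp (θ * v) * expConv θ (rhoG H P) (Iic 0) v := by fun_prop
  have hI : ∀ v, HasDerivAt (fun x => ∫ v in (0 : ℝ)..x,
      Real.exp (θ * v) * expConv θ (rhoG H P) (Iic 0) v)
      (Real.exp (θ * v) * expConv θ (rhoG H P) (Iic 0) v) v := fun v =>
    intervalIntegral.integral_hasDerivAt_right (hc.intervalIntegrable _ _)
      (hc.stronglyMeasurableAtFilter _ _) hc.continuousAt
  have hr := hH.continuous_rho
  have hIc : Continuous fun x => ∫ v in (0 : ℝ)..x,
      Real.exp (θ * v) * expConv θ (rhoG H P) (Iic 0) v :=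
    continuous_iff_continuousAt.2 fun v => (hI v).continuousAt
  -- Twice the covariance of `ouPast` and `ouXi x`. It vanishes at `x = 0`, and its derivative at `v
  -- > 0` is the inner improper integral.
  have hE : Continuous fun x => -(Real.exp (θ * x) * rhoG H P x) + θ ^ 2 * ∫ v in (0 : ℝ)..x,
      Real.exp (θ * v) * expConv θ (rhoG H P) (Iic 0) v := by fun_prop
  have hLeq := hL.eq_sub_of_hasDerivAt ht hE fun v hv => by
    rw [(hJ v hv).eq_of_expGrowth hρ hκ hκθ hg hv.1]
    have h1 := hρ.two_compl_zero.1 v hv.1.ne'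
    refine (((hasDerivAt_exp_mul_const θ v).mul h1).neg.add
      ((hI v).const_mul (θ ^ 2))).congr_deriv ?_
    ring
  simp only [intervalIntegral.integral_same, hH.rho_zero, mul_zero, neg_zero, add_zero,
    sub_zero] at hLeq
  have i1 : Integrable (fun ω => Real.exp (-θ * t) * (ouPast θ fun s => H s ω) ^ 2) P :=
    (hH.memLp_ouPast hθ).integrable_sq.const_mul _
  have i2 : Integrable (fun ω => Real.exp (-θ * t) * ((ouPast θ fun s => H s ω) *
      ouXi θ (fun s => H s ω) t)) P :=
    ((hH.memLp_ouPast hθ).integrable_mul (hH.memLp_ouXi hθ ht)).const_mul _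
  have e : ∀ ω, ouZ θ H t ω * ouZ θ H 0 ω =
      Real.exp (-θ * t) * (ouPast θ fun s => H s ω) ^ 2 + Real.exp (-θ * t) *
        ((ouPast θ fun s => H s ω) * ouXi θ (fun s => H s ω) t) := fun ω => by
    rw [hH.ouZ_eq hθ t, hH.ouZ_zero hθ]; ring
  simp_rw [e, hH.ouZ_zero hθ]
  rw [integral_add i1 i2, integral_const_mul, integral_const_mul,
    hH.integral_ouPast_mul_ouXi hθ ht, hLeq]
  ring

theorem integral_ouX_mul_ouX (hH : IsRegularProcess H P) (hθ : 0 < θ)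
    (hρ : ContDiffOn ℝ 2 (rhoG H P) {0}ᶜ) {s t : ℝ} (hs : 0 ≤ s) (hst : s ≤ t) {L : ℝ}
    (hL : HasImproperIntegral (𝓝[>] s) t
      (fun v => Real.exp (θ * v) *
        ∫ u in (0 : ℝ)..s, Real.exp (θ * u) * deriv (deriv (rhoG H P)) (v - u)) L) :
    ∫ ω, ouX θ H s ω * ouX θ H t ω ∂P =
      Real.exp (-θ * (t - s)) * ∫ ω, (ouX θ H s ω) ^ 2 ∂P +
        Real.exp (-θ * t) * Real.exp (-θ * s) / 2 * L := by
  have hr := hH.continuous_rho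
  have hΨ := continuous_expConv_of_hasDerivAt (hasDerivAt_exp_mul_expConv_Ioc (θ := θ) hr hs)
  have hc : Continuous fun v => Real.exp (θ * v) * expConv θ (rhoG H P) (Ioc 0 s) v := by
    fun_prop
  have hI : ∀ v, HasDerivAt (fun x => ∫ v in s..x,
      Real.exp (θ * v) * expConv θ (rhoG H P) (Ioc 0 s) v)
      (Real.exp (θ * v) * expConv θ (rhoG H P) (Ioc 0 s) v) v := fun v =>
    intervalIntegral.integral_hasDerivAt_right (hc.intervalIntegrable _ _)
      (hc.stronglyMeasurableAtFilter _ _) hc.continuousAt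
  have hIc : Continuous fun x => ∫ v in s..x,
      Real.exp (θ * v) * expConv θ (rhoG H P) (Ioc 0 s) v :=
    continuous_iff_continuousAt.2 fun v => (hI v).continuousAt
  have hE : Continuous fun x => Real.exp (θ * x) * rhoG H P x -
      Real.exp (θ * s) * (Real.exp (θ * x) * rhoG H P (x - s)) + θ ^ 2 * ∫ v in s..x,
      Real.exp (θ * v) * expConv θ (rhoG H P) (Ioc 0 s) v := by fun_prop
  have hLeq := hL.eq_sub_of_hasDerivAt hst hE fun v hv => by
    rw [integral_exp_mul_deriv_deriv hρ hr hs hv.1]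
    have h1 := hρ.two_compl_zero.1 v (hs.trans_lt hv.1).ne'
    have hsv : HasDerivAt (fun x : ℝ => x - s) 1 v := (hasDerivAt_id v).sub_const s
    have h2 := (hρ.two_compl_zero.1 (v - s) (sub_pos.2 hv.1).ne').comp v hsv
    refine ((((hasDerivAt_exp_mul_const θ v).mul h1).sub
      (((hasDerivAt_exp_mul_const θ v).mul h2).const_mul (Real.exp (θ * s)))).add
      ((hI v).const_mul (θ ^ 2))).congr_deriv ?_
    rw [expConv, ← intervalIntegral.integral_of_le hs]
    simp only [Function.comp_apply, mul_zero, Real.exp_zero, sub_zero]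
    ring
  simp only [intervalIntegral.integral_same, sub_self, hH.rho_zero, mul_zero, add_zero,
    sub_zero] at hLeq
  have hXs := hH.memLp_ouXi hθ hs
  have hXt := hH.memLp_ouXi hθ (hs.trans hst)
  have hee : Real.exp (-θ * (t - s)) * Real.exp (-θ * s) = Real.exp (-θ * t) := by
    rw [← Real.exp_add]; ring_nf
  have e : ∀ ω, ouX θ H s ω * ouX θ H t ω =
      Real.exp (-θ * t) * Real.exp (-θ * s) * (ouXi θ (fun r => H r ω) s) ^ 2 +
      Real.exp (-θ * t) * Real.exp (-θ * s) * (ouXi θ (fun r => H r ω) s *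
        (ouXi θ (fun r => H r ω) t - ouXi θ (fun r => H r ω) s)) := fun ω => by
    rw [hH.ouX_eq hs, hH.ouX_eq (hs.trans hst)]; ring
  have e' : ∀ ω, (ouX θ H s ω) ^ 2 =
      (Real.exp (-θ * s)) ^ 2 * (ouXi θ (fun r => H r ω) s) ^ 2 := fun ω => by
    rw [hH.ouX_eq hs]; ring
  have i1 : Integrable (fun ω => Real.exp (-θ * t) * Real.exp (-θ * s) *
      (ouXi θ (fun r => H r ω) s) ^ 2) P := hXs.integrable_sq.const_mul _
  have i2 : Integrable (fun ω => Real.exp (-θ * t) * Real.exp (-θ * s) *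
      (ouXi θ (fun r => H r ω) s *
        (ouXi θ (fun r => H r ω) t - ouXi θ (fun r => H r ω) s))) P :=
    (hXs.integrable_mul (hXt.sub hXs)).const_mul _
  simp_rw [e, e']
  rw [integral_add i1 i2, integral_const_mul, integral_const_mul, integral_const_mul,
    hH.integral_ouXi_mul_ouXi_sub hθ hs hst, hLeq, ← hee]
  ring

/-- Expand the square of `X t = Z t - x Z 0` with `x = e^{-θ t} ≤ 1`. By stationarity all second
moments of `Z` equal `V`, so the error is at most `x ^ 2 V + 2 x V ≤ 3 x V`. -/
theorem abs_integral_ouX_sq_sub_le (hH : IsRegularProcess H P) (hθ : 0 < θ)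
    (hZ : IsStationaryProcess (ouZ θ H) P) {t : ℝ} (ht : 0 ≤ t) :
    |∫ ω, (ouX θ H t ω) ^ 2 ∂P - ∫ ω, (ouZ θ H 0 ω) ^ 2 ∂P| ≤
      3 * (∫ ω, (ouZ θ H 0 ω) ^ 2 ∂P) * Real.exp (-θ * t) := by
  set x := Real.exp (-θ * t) with hx
  have hx0 : 0 < x := Real.exp_pos _
  have hx1 : x ≤ 1 := Real.exp_le_one_iff.2 (by nlinarith)
  have hV : ∫ ω, (ouZ θ H t ω) ^ 2 ∂P = ∫ ω, (ouZ θ H 0 ω) ^ 2 ∂P := by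
    have h := (hZ t ht 1 (fun _ => 0) fun _ => le_rfl).comp (measurable_pi_apply 0)
    simpa [Function.comp_def] using h.sq.integral_eq
  have mt := hH.memLp_ouZ hθ ht
  have m0 := hH.memLp_ouZ hθ le_rfl
  have it := mt.integrable_sq
  have i0 := m0.integrable_sq
  have itz : Integrable (fun ω => ouZ θ H t ω * ouZ θ H 0 ω) P := mt.integrable_mul m0
  have e : ∀ ω, (ouX θ H t ω) ^ 2 = (ouZ θ H t ω) ^ 2 + x ^ 2 * (ouZ θ H 0 ω) ^ 2 -
      2 * x * (ouZ θ H t ω * ouZ θ H 0 ω) := fun ω => by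
    rw [hH.ouX_eq ht, hH.ouZ_eq hθ t, hH.ouZ_zero hθ]; ring
  have j1 : Integrable (fun ω => (ouZ θ H t ω) ^ 2 + x ^ 2 * (ouZ θ H 0 ω) ^ 2) P :=
    it.add (i0.const_mul _)
  have hX : ∫ ω, (ouX θ H t ω) ^ 2 ∂P = ∫ ω, (ouZ θ H 0 ω) ^ 2 ∂P +
      x ^ 2 * (∫ ω, (ouZ θ H 0 ω) ^ 2 ∂P) - 2 * x * ∫ ω, ouZ θ H t ω * ouZ θ H 0 ω ∂P := by
    simp_rw [e]
    rw [integral_sub j1 (itz.const_mul _), integral_add it (i0.const_mul _), integral_const_mul,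
      integral_const_mul, hV]
  have hle : |∫ ω, ouZ θ H t ω * ouZ θ H 0 ω ∂P| ≤ ∫ ω, (ouZ θ H 0 ω) ^ 2 ∂P := by
    have h1 : ∫ ω, ((ouZ θ H t ω) ^ 2 + (ouZ θ H 0 ω) ^ 2) / 2 ∂P =
        ∫ ω, (ouZ θ H 0 ω) ^ 2 ∂P := by
      rw [integral_div, integral_add it i0, hV]; ring
    rw [← h1, ← Real.norm_eq_abs]
    refine norm_integral_le_of_norm_le ((it.add i0).div_const 2) (ae_of_all _ fun ω => ?_)
    rw [Real.norm_eq_abs, abs_le]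
    constructor
    · linarith [sq_nonneg (ouZ θ H t ω + ouZ θ H 0 ω)]
    · linarith [sq_nonneg (ouZ θ H t ω - ouZ θ H 0 ω)]
  have hV0 : 0 ≤ ∫ ω, (ouZ θ H 0 ω) ^ 2 ∂P := integral_nonneg fun ω => sq_nonneg _
  rw [hX]
  rw [abs_le] at hle ⊢
  constructor <;> nlinarith [mul_nonneg hx0.le hV0, mul_nonneg (mul_nonneg hx0.le hV0)
    (sub_nonneg.2 hx1), mul_le_mul_of_nonneg_left hle.1 hx0.le,
    mul_le_mul_of_nonneg_left hle.2 hx0.le]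

theorem integral_ouZ_zero_sq (hH : IsRegularProcess H P) (hθ : 0 < θ) :
    IntegrableOn (fun t => Real.exp (-θ * t) * rhoG H P t) (Ioi 0) ∧
      ∫ ω, (ouZ θ H 0 ω) ^ 2 ∂P =
        θ / 2 * ∫ t in Ioi (0 : ℝ), Real.exp (-θ * t) * rhoG H P t := by
  have hi := (hH.expGrowth_rho (half_pos hθ)).integrableOn (half_pos hθ).le (half_lt_self hθ) 0
  have e : ∀ t, Real.exp (-θ * t) * rhoG H P t = Real.exp (θ * -t) * rhoG H P (-t) := fun t => by
    rw [hH.rho_neg, mul_neg, neg_mul]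
  simp_rw [e, hH.ouZ_zero hθ]
  constructor
  · rw [← neg_zero] at hi
    exact hi.comp_neg_Ici.mono_set Ioi_subset_Ici_self
  · rw [hH.integral_ouPast_sq hθ, integral_comp_neg_Ioi 0
      (fun u => Real.exp (θ * u) * rhoG H P u), neg_zero]

end IsRegularProcess

/-! ### Transfer from the regular version to an arbitrary continuous modification -/

theorem theorem3p1 {Ω : Type*} [MeasurableSpace Ω] (P : Measure Ω) [IsProbabilityMeasure P]
    (θ : ℝ) (hθ : 0 < θ) (G : ℝ → Ω → ℝ)
    (hmeas : Measurable (fun p : ℝ × Ω => G p.1 p.2))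
    (hstat : HasStationaryIncrements G P)
    (hA : IncrementMomentAssumption G P) :
    -- `G` has a continuous modification, and the integrals are those of any such modification
    (∃ G' : ℝ → Ω → ℝ, IsContinuousModification P G G') ∧
    ∀ G' : ℝ → Ω → ℝ, IsContinuousModification P G G' →
      -- the pathwise Riemann-Stieltjes integrals in `Z` and `X` exist
      (∀ᵐ ω ∂P, ∀ t : ℝ,
        ∃ I, HasRSIntegralIic (fun s => Real.exp (-θ * (t - s))) (fun s => G' s ω) t I) ∧
      (∀ᵐ ω ∂P, ∀ t : ℝ, 0 ≤ t →
        ∃ I, HasRSIntegral (fun r => Real.exp (θ * r)) (fun r => G' r ω) 0 t I) ∧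
      -- (a) `Z` is the continuous solution of the Langevin equation, and it is stationary
      ((∀ᵐ ω ∂P,
          IsLangevinSolution θ (fun t => G' t ω)
            (rsIntegralIic (fun s => Real.exp (θ * s)) (fun s => G' s ω) 0)
            (fun t => ouZ θ G' t ω) ∧
          ∀ y : ℝ → ℝ,
            IsLangevinSolution θ (fun t => G' t ω)
              (rsIntegralIic (fun s => Real.exp (θ * s)) (fun s => G' s ω) 0) y →
            ∀ t, 0 ≤ t → y t = ouZ θ G' t ω) ∧
        IsStationaryProcess (ouZ θ G') P) ∧
      -- (b)
      (ContDiffOn ℝ 2 (rhoG G P) {0}ᶜ →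
        (∀ t : ℝ, 0 ≤ t → MemLp (ouZ θ G' t) 2 P ∧ MemLp (ouX θ G' t) 2 P) ∧
        (∀ t : ℝ, 0 ≤ t → ∀ (J : ℝ → ℝ) (L : ℝ),
          (∀ v ∈ Ioo 0 t, HasImproperIntegral atBot 0
            (fun u => Real.exp (θ * u) * Real.exp (θ * v) * deriv (deriv (rhoG G P)) (v - u))
            (J v)) →
          HasImproperIntegral (𝓝[>] 0) t J L →
          ∫ ω, ouZ θ G' t ω * ouZ θ G' 0 ω ∂P =
            Real.exp (-θ * t) * ∫ ω, (ouZ θ G' 0 ω) ^ 2 ∂P + Real.exp (-θ * t) / 2 * L) ∧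
        (∀ s t : ℝ, 0 ≤ s → s ≤ t → ∀ L : ℝ,
          HasImproperIntegral (𝓝[>] s) t
            (fun v => Real.exp (θ * v) *
              ∫ u in (0 : ℝ)..s, Real.exp (θ * u) * deriv (deriv (rhoG G P)) (v - u)) L →
          ∫ ω, ouX θ G' s ω * ouX θ G' t ω ∂P =
            Real.exp (-θ * (t - s)) * ∫ ω, (ouX θ G' s ω) ^ 2 ∂P +
              Real.exp (-θ * t) * Real.exp (-θ * s) / 2 * L) ∧
        (∃ C : ℝ, ∀ t : ℝ, 0 ≤ t →
          |∫ ω, (ouX θ G' t ω) ^ 2 ∂P - ∫ ω, (ouZ θ G' 0 ω) ^ 2 ∂P| ≤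
            C * Real.exp (-θ * t)) ∧
        (IntegrableOn (fun t => Real.exp (-θ * t) * rhoG G P t) (Ioi 0) ∧
          ∫ ω, (ouZ θ G' 0 ω) ^ 2 ∂P =
            θ / 2 * ∫ t in Ioi (0 : ℝ), Real.exp (-θ * t) * rhoG G P t)) := by
  obtain ⟨H, hHm, hHc, hH0, hHg, hHG⟩ :=
    exists_regular_version (G := G) (fun t => hmeas.comp measurable_prodMk_left) hA
  refine ⟨⟨H, hHG, ae_of_all _ hHc⟩, fun G' hG' => ?_⟩
  have hκ := half_pos hθ
  have hκθ := half_lt_self hθ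
  have hgrow : ∀ ω, ExpGrowth (θ / 2) fun t => H t ω := fun ω => by
    obtain ⟨C, hC⟩ := hHg ω
    exact ExpGrowth.of_le_sq hκ (hHc ω) hC
  -- Equality of whole paths is needed, not only at each fixed time, because the integrals are
  -- functionals of the path.
  have hpath : ∀ᵐ ω ∂P, (fun t => G' t ω) = fun t => H t ω := by
    filter_upwards [ae_forall_eq_of_continuous hG'.2 (ae_of_all _ hHc)
      fun t => (hG'.1 t).trans (hHG t).symm] with ω hω using funext hω
  have hZ : ∀ᵐ ω ∂P, ∀ t, ouZ θ G' t ω = ouZ θ H t ω := by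
    filter_upwards [hpath] with ω hω t
    rw [ouZ, hω, ouZ]
  have hX : ∀ᵐ ω ∂P, ∀ t, ouX θ G' t ω = ouX θ H t ω := by
    filter_upwards [hpath] with ω hω t
    rw [ouX, hω, ouX]
  have hZt : ∀ t, ouZ θ G' t =ᵐ[P] ouZ θ H t := fun t => hZ.mono fun ω h => h t
  have hXt : ∀ t, ouX θ G' t =ᵐ[P] ouX θ H t := fun t => hX.mono fun ω h => h t
  have hIic : ∀ᵐ ω ∂P, ∀ t : ℝ,
      ∃ I, HasRSIntegralIic (fun s => Real.exp (-θ * (t - s))) (fun s => G' s ω) t I := by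
    filter_upwards [hpath] with ω hω t
    rw [hω]
    exact ⟨_, hasRSIntegralIic_exp_shift hκ.le hκθ (hgrow ω) t⟩
  have hstatZ : ∀ K : ℝ → Ω → ℝ, (∀ t, K t =ᵐ[P] G t) → (∀ᵐ ω ∂P, ∀ t : ℝ,
      ∃ I, HasRSIntegralIic (fun s => Real.exp (-θ * (t - s))) (fun s => K s ω) t I) →
      IsStationaryProcess (ouZ θ K) P := fun K hK => (hstat.congr hK).isStationaryProcess_ouZ
  refine ⟨hIic, ?_, ⟨?_, hstatZ G' hG'.1 hIic⟩, fun hρ => ?_⟩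
  · filter_upwards [hpath] with ω hω t ht
    rw [hω]
    exact ⟨_, hasRSIntegral_exp_zero (hHc ω) (hH0 ω) ht⟩
  · filter_upwards [hpath, hZ] with ω hω hZω
    have hsol := isLangevinSolution_exp hκ.le hκθ (hgrow ω)
    rw [hω, (hasRSIntegralIic_exp hκ.le hκθ (hgrow ω) (hH0 ω)).rsIntegralIic_eq,
      show (fun t => ouZ θ G' t ω) = fun t => Real.exp (-θ * t) *
        (ouPast θ (fun s => H s ω) + ouXi θ (fun s => H s ω) t) from
        funext fun t => (hZω t).trans (ouZ_eq hκ.le hκθ (hgrow ω) t)]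
    refine ⟨hsol, fun y hy t ht => ?_⟩
    rw [hZω t, ouZ_eq hκ.le hκθ (hgrow ω) t]
    exact hy.unique hsol ht
  · have hreg := hA.isRegularProcess hHm hHc hH0 hHg hHG hstat hρ.continuousOn
    rw [← rhoG_congr hHG] at hρ ⊢
    have hZ2 : ∫ ω, (ouZ θ G' 0 ω) ^ 2 ∂P = ∫ ω, (ouZ θ H 0 ω) ^ 2 ∂P :=
      integral_congr_ae ((hZt 0).fun_comp fun x => x ^ 2)
    have hX2 : ∀ t, ∫ ω, (ouX θ G' t ω) ^ 2 ∂P = ∫ ω, (ouX θ H t ω) ^ 2 ∂P := fun t =>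
      integral_congr_ae ((hXt t).fun_comp fun x => x ^ 2)
    simp_rw [hZ2, hX2]
    refine ⟨fun t ht => ⟨(memLp_congr_ae (hZt t)).2 (hreg.memLp_ouZ hθ ht),
      (memLp_congr_ae (hXt t)).2 (hreg.memLp_ouX hθ ht)⟩, ?_, ?_, ?_, ?_⟩
    · intro t ht J L hJ hL
      refine (integral_congr_ae ((hZt t).mul (hZt 0))).trans ?_
      exact hreg.integral_ouZ_mul_ouZ_zero hθ hρ ht hJ hL
    · intro s t hs hst L hL
      refine (integral_congr_ae ((hXt s).mul (hXt t))).trans ?_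
      exact hreg.integral_ouX_mul_ouX hθ hρ hs hst hL
    · exact ⟨_, fun t ht => hreg.abs_integral_ouX_sq_sub_le hθ (hstatZ H hHG (ae_of_all _
        fun ω t => ⟨_, hasRSIntegralIic_exp_shift hκ.le hκθ (hgrow ω) t⟩)) ht⟩
    · exact hreg.integral_ouZ_zero_sq hθ
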